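/- **Proposition (Strong maximum principle).** Let $0<s<1$, let $\Omega\subset\mathbb{R}^n$ be a bounded Lipschitz domain and put $\Omega_e:=\mathbb{R}^n\setminus\overline\Omega$. With the usual constant $C_{n,s}=\frac{4^s\Gamma(n/2+s)}{\pi^{n/2}|\Gamma(-s)|}$, let $$\nabla^s u(x,y)=\sqrt{\tfrac{C_{n,s}}{2}}\,\frac{u(x)-u(y)}{|y-x|^{n/2+s+1}}\,(y-x),\qquad \nabla^s_A u(x,y)=\nabla^s u(x,y)+A(x,y)u(x),$$ and define $(-\Delta)^s_A$ and $(\nabla\cdot)^s$ by duality: $\langle(-\Delta)^s_A u,\varphi\rangle=\int_{\mathbb{R}^{2n}}\nabla^s_A u\cdot\nabla^s_A\varphi\,dx\,dy$ and $\langle(\nabla\cdot)^s B,\psi\rangle=\int_{\mathbb{R}^{2n}}B\cdot\nabla^s\psi\,dx\,dy$. Let $A:\mathbb{R}^n\times\mathbb{R}^n\to\mathbb{R}^n$ be a compactly supported $C^s$ (Hölder) vector field and let $q\in L^\infty(\Omega,\mathbb{R})$. Let $A_s(x,y)=\frac12(A(x,y)+A(y,x))$ and $A_a=A-A_s$ be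 the symmetric and antisymmetric parts of $A$; for a field $B$ let $B_{\|}(x,y)=\frac{B(x,y)\cdot(x-y)}{|x-y|^2}(x-y)$ if $x\ne y$ and $B_{\|}(x,x)=B(x,x)$. Assume that $$A_{s\|}\in H^s(\mathbb{R}^{2n}),\qquad A_{a\|}(x,y)\cdot(y-x)\ge0\quad\text{in }\mathbb{R}^n\times\mathbb{R}^n,$$ $$(\nabla\cdot)^sA_{s\|}+\int_{\mathbb{R}^n}|A(x,y)|^2\,dy+q(x)\ge0\quad\text{in }\Omega\text{, in the sense of distributions.}$$ Let $0\le F\in L^\infty(\Omega)$ and $0\le g\in L^\infty(\Omega_e)$, where $g$ is not almost everywhere zero, and let $u$ be a weak solution of $$(-\Delta)^s_Au+qu=F\ \text{ in }\Omega,\qquad u=g\ \text{ in }\Omega_e.$$ That is, $u:\mathbb{R}^n\to\mathbb{R}$ satisfies $u|_\Omega\in H^s(\Omega)$, $\nabla^su\in L^2(\Omega\times\mathbb{R}^n)$ (the latter is automatic if $u\in H^s(\mathbb{R}^n)$), $u=g$ a.e. in $\Omega_e$, and $$\langle(-\Delta)^s_Au,\varphi\rangle+\int_\Omega qu\varphi\,dx=\int_\Omega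 F\varphi\,dx$$ for every $\varphi\in\widetilde H^s(\Omega)$, the closure of $C_c^\infty(\Omega)$ in $H^s(\mathbb{R}^n)$. Then $u>0$ almost everywhere in $\Omega$. -/

import Mathlib

open MeasureTheory Set
open scoped NNReal InnerProductSpace ContDiff

noncomputable section

namespace FracMagnetic

/-- `ℝⁿ` with its Euclidean norm and Lebesgue measure. -/
abbrev E (n : ℕ) : Type := EuclideanSpace ℝ (Fin n)

/-! ### Sobolev spaces of fractional order -/

section Sobolev

variable {V W : Type*} [NormedAddCommGroup V] [NormedSpace ℝ V] [MeasureSpace V]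
  [NormedAddCommGroup W] [NormedSpace ℝ W]

/-- The Gagliardo quotient `(f x - f y) / |x - y| ^ (d / 2 + s)`, where `d = dim V`. -/
def gagliardoQuotient (s : ℝ) (f : V → W) (p : V × V) : W :=
  (‖p.1 - p.2‖ ^ ((Module.finrank ℝ V : ℝ) / 2 + s))⁻¹ • (f p.1 - f p.2)

/-- The norm of `H^s(V) = W^{s,2}(V)`, `0 < s < 1`: the `L²` norm of `f` plus the `L²` norm of its
Gagliardo quotient (with value `∞` if `f` is not in the space). -/
def sobolevNorm (s : ℝ) (f : V → W) : ENNReal :=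
  eLpNorm f 2 volume + eLpNorm (gagliardoQuotient s f) 2 volume

/-- `f ∈ H^s(V) = W^{s,2}(V)`, for `0 < s < 1`. -/
def MemSobolev (s : ℝ) (f : V → W) : Prop :=
  AEStronglyMeasurable f volume ∧ sobolevNorm s f < ⊤

end Sobolev

variable {n : ℕ}

/-- `ψ ∈ C_c^∞(U)`, extended by zero to `ℝⁿ`. -/
def IsTestFunction (U : Set (E n)) (ψ : E n → ℝ) : Prop :=
  ContDiff ℝ ∞ ψ ∧ HasCompactSupport ψ ∧ tsupport ψ ⊆ U

/-- `u ∈ H^s(U)`: on `U`, the function `u` agrees with an element of `H^s(ℝⁿ)`. -/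
def MemSobolevOn (s : ℝ) (U : Set (E n)) (u : E n → ℝ) : Prop :=
  ∃ v : E n → ℝ, MemSobolev s v ∧ u =ᵐ[volume.restrict U] v

/-- `φ ∈ H̃^s(U)`: `φ` lies in the closure of `C_c^∞(U)` in `H^s(ℝⁿ)`. -/
def MemSobolevTilde (s : ℝ) (U : Set (E n)) (φ : E n → ℝ) : Prop :=
  MemSobolev s φ ∧
    ∀ ε : ENNReal, 0 < ε → ∃ ψ : E n → ℝ, IsTestFunction U ψ ∧ sobolevNorm s (φ - ψ) < ε

/-! ### Lipschitz domains -/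

/-- An open set `U` whose boundary is locally the graph of a Lipschitz function, with `U` on one
side: near each boundary point, there are a unit vector `e` and a Lipschitz function `γ` of the
component `y - ⟪e, y⟫ e` of `y` orthogonal to `e` such that `U` is the set where
`γ (y - ⟪e, y⟫ e) < ⟪e, y⟫`. -/
def IsLipschitzDomain (U : Set (E n)) : Prop :=
  IsOpen U ∧ ∀ p ∈ frontier U, ∃ (e : E n) (r : ℝ) (γ : E n → ℝ) (K : ℝ≥0),
    ‖e‖ = 1 ∧ 0 < r ∧ LipschitzWith K γ ∧
      ∀ y ∈ Metric.ball p r, y ∈ U ↔ γ (y - ⟪e, y⟫_ℝ • e) < ⟪e, y⟫_ℝ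

/-! ### The magnetic potential -/

/-- `A ∈ C^s_c(ℝⁿ × ℝⁿ, ℝⁿ)`: `A` is Hölder continuous of exponent `s` and has compact support. -/
def IsHolderCompact (s : ℝ) (A : E n × E n → E n) : Prop :=
  (∃ C : ℝ≥0, HolderWith C s.toNNReal A) ∧ HasCompactSupport A

/-- The symmetric part `A_s` of a vector field on `ℝⁿ × ℝⁿ`. -/
def symmPart (A : E n × E n → E n) (p : E n × E n) : E n :=
  (1 / 2 : ℝ) • (A (p.1, p.2) + A (p.2, p.1))

/-- The antisymmetric part `A_a = A - A_s`. -/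
def antisymmPart (A : E n × E n → E n) (p : E n × E n) : E n :=
  A p - symmPart A p

open Classical in
/-- The parallel part `A_∥`: the projection of `A(x, y)` onto the direction `x - y`. -/
def parallelPart (A : E n × E n → E n) (p : E n × E n) : E n :=
  if p.1 ≠ p.2 then (⟪A p, p.1 - p.2⟫_ℝ / ‖p.1 - p.2‖ ^ 2) • (p.1 - p.2) else A p

/-! ### Fractional gradient and divergence, and the magnetic operator -/

/-- The constant of the fractional Laplacian,
`C_{n,s} = 4^s Γ(n/2 + s) / (π^{n/2} |Γ(-s)|)`. -/
def fracConst (n : ℕ) (s : ℝ) : ℝ :=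
  4 ^ s * Real.Gamma ((n : ℝ) / 2 + s) / (Real.pi ^ ((n : ℝ) / 2) * |Real.Gamma (-s)|)

/-- The fractional gradient
`∇^s u (x, y) = √(C_{n,s} / 2) * (u x - u y) / |y - x| ^ (n / 2 + s + 1) * (y - x)`. -/
def fracGrad (s : ℝ) (u : E n → ℝ) (p : E n × E n) : E n :=
  (Real.sqrt (fracConst n s / 2) * (u p.1 - u p.2) /
    ‖p.2 - p.1‖ ^ ((n : ℝ) / 2 + s + 1)) • (p.2 - p.1)

/-- The fractional divergence `(∇·)^s B` acting on `ψ` by duality: `⟨B, ∇^s ψ⟩`. -/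
def fracDiv (s : ℝ) (B : E n × E n → E n) (ψ : E n → ℝ) : ℝ :=
  ∫ p : E n × E n, ⟪B p, fracGrad s ψ p⟫_ℝ

/-- The magnetic fractional gradient `∇^s_A u (x, y) = ∇^s u (x, y) + A(x, y) u(x)`. -/
def magGrad (s : ℝ) (A : E n × E n → E n) (u : E n → ℝ) (p : E n × E n) : E n :=
  fracGrad s u p + u p.1 • A p

/-- The magnetic fractional Laplacian `(-Δ)^s_A u` acting on `φ`: `⟨∇^s_A u, ∇^s_A φ⟩`. -/
def magLaplacian (s : ℝ) (A : E n × E n → E n) (u φ : E n → ℝ) : ℝ :=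
  ∫ p : E n × E n, ⟪magGrad s A u p, magGrad s A φ p⟫_ℝ

/-- The two conditions on the magnetic potential alone: `A_{s∥} ∈ H^s(ℝ²ⁿ)`, and
`A_{a∥}(x, y) · (y - x) ≥ 0` on `ℝⁿ × ℝⁿ`. (The norm of the product `ℝⁿ × ℝⁿ` is equivalent to the
Euclidean norm of `ℝ²ⁿ`, so that it gives the same Sobolev space.) -/
def MagneticCondition (s : ℝ) (A : E n × E n → E n) : Prop :=
  MemSobolev s (parallelPart (symmPart A)) ∧
    ∀ x y : E n, 0 ≤ ⟪parallelPart (antisymmPart A) (x, y), y - x⟫_ℝ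

/-- `(∇·)^s A_{s∥} + ∫ |A(x, y)|² dy + q(x) ≥ 0` in `Ω`, in the sense of distributions: the
left-hand side is nonnegative on each nonnegative `ψ ∈ C_c^∞(Ω)`. -/
def PotentialCondition (s : ℝ) (Ω : Set (E n)) (A : E n × E n → E n) (q : E n → ℝ) : Prop :=
  ∀ ψ : E n → ℝ, IsTestFunction Ω ψ → (∀ x, 0 ≤ ψ x) →
    0 ≤ fracDiv s (parallelPart (symmPart A)) ψ
      + ∫ x in Ω, ((∫ y : E n, ‖A (x, y)‖ ^ 2) + q x) * ψ x

/-- `u` is a weak solution of `(-Δ)^s_A u + q u = F` in `Ω`, `u = g` in `Ω_e = ℝⁿ \ closure Ω`.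

Besides `u ∈ H^s(Ω)`, we ask that `∇^s u` be square integrable on `Ω × ℝⁿ`: this is what gives a
meaning to the pairing of `(-Δ)^s_A u` with elements of `H̃^s(Ω)`. It holds whenever
`u ∈ H^s(ℝⁿ)`, and also allows bounded exterior values that do not decay. -/
structure IsWeakSolution (s : ℝ) (Ω : Set (E n)) (A : E n × E n → E n) (q F g u : E n → ℝ) :
    Prop where
  memSobolevOn : MemSobolevOn s Ω u
  energy : MemLp (fracGrad s u) 2 (volume.restrict (Ω ×ˢ univ))
  exterior : u =ᵐ[volume.restrict (closure Ω)ᶜ] g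
  weak : ∀ φ : E n → ℝ, MemSobolevTilde s Ω φ →
    magLaplacian s A u φ + ∫ x in Ω, q x * u x * φ x = ∫ x in Ω, F x * φ x

end FracMagnetic

end

noncomputable section

namespace FracMagnetic

variable {n : ℕ} {s : ℝ}

/-! ### Square integrable functions on a product -/

/-! Write c for √(C_{n,s}/2), κ(x,y) = |x - y|^{-(n/2+s)}, and let a be the component of A_a in the
direction from x to y. Exchanging x and y kills the part of the magnetic energy that is odd under
the swap. What remains (`magLaplacian_eq`, `IsWeakSolution.energy_eq`) is the identity ∫ E(u,φ) +
P(uφ) = ∫ Fφ. Here E(u,φ) is (c²κ² + c a κ)(u(x) - u(y))(φ(x) - φ(y)), whose weight is nonnegative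
by the sign condition on A_a. The functional P is the one in `PotentialCondition`; it sees only the
product uφ.

P is nonnegative on squares of functions in H̃^s: (v,z) ↦ P(vz) is bounded on H^s × H^s, and squares
of test functions are admissible in the hypothesis
(`PotentialCondition.potentialForm_mul_self_nonneg`). To make the test functions below legitimate,
an H^s function vanishing off a bounded Lipschitz domain is approximated by test functions:
localize, push into the domain, mollify (`IsLipschitzDomain.memSobolevTilde`).

Weak principle (`IsWeakSolution.nonneg`): test with the negative part φ of u. Then uφ = -φ², so P
has a good sign and the Gagliardo seminorm of φ vanishes. Thus φ is constant, and it is zero on the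
exterior.

Strong principle (`IsWeakSolution.ae_eq_zero_of_eq_zero`): test with η²/(u+ε). Since uη²/(u+ε) = η²
- w² with w = η√(ε/(u+ε)), the term P(w²) can be dropped, and -∫ E(u, η²/(u+ε)) ≤ P(η²) uniformly in
ε. Picone's inequality makes E(η,η) - E(u, η²/(u+ε)) nonnegative. Where u(x) = 0 and y is exterior,
it is at least c²κ² u(y)η(x)²/ε. Multiplying by ε and letting ε → 0 shows that η vanishes almost
everywhere on the zero set of u, because u = g is not almost everywhere zero outside. -/

lemma memLp_two_mul_prod {f g : E n → ℝ} (hf : MemLp f 2 volume) (hg : MemLp g 2 volume) :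
    MemLp (fun p : E n × E n => f p.1 * g p.2) 2 volume := by
  refine (memLp_two_iff_integrable_sq (hf.1.comp_fst.mul hg.1.comp_snd)).2 ?_
  simpa only [Pi.mul_apply, mul_pow] using hf.integrable_sq.mul_prod hg.integrable_sq

/-- A bounded measurable function supported in `K ×ˢ K` for some compact `K`. -/
structure IsBddCompact (b : E n × E n → ℝ) : Prop where
  measurable : Measurable b
  bound : ∃ (M : ℝ) (K : Set (E n)), IsCompact K ∧
    ∀ p, |b p| ≤ M * (K.indicator 1 p.1 * K.indicator 1 p.2)

/-- A measurable function that is square integrable on compact sets. -/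
structure LocL2 (u : E n → ℝ) : Prop where
  meas : AEStronglyMeasurable u volume
  memLp : ∀ K : Set (E n), IsCompact K → MemLp u 2 (volume.restrict K)

lemma LocL2.of_memLp {u : E n → ℝ} (hu : MemLp u 2 volume) : LocL2 u :=
  ⟨hu.1, fun _ _ => hu.restrict _⟩

lemma IsBddCompact.comp_swap {b : E n × E n → ℝ} (hb : IsBddCompact b) :
    IsBddCompact (fun p : E n × E n => b p.swap) := by
  obtain ⟨M, K, hK, h⟩ := hb.bound
  refine ⟨hb.measurable.comp measurable_swap, M, K, hK, fun p => ?_⟩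
  rw [mul_comm (K.indicator 1 p.1)]
  exact h p.swap

lemma memLp_swap {f : E n × E n → ℝ} (hf : MemLp f 2 volume) :
    MemLp (fun p : E n × E n => f p.swap) 2 volume :=
  hf.comp_measurePreserving Measure.measurePreserving_swap

lemma integral_comp_swap (f : E n × E n → ℝ) : ∫ p : E n × E n, f p.swap = ∫ p, f p :=
  integral_prod_swap f

/-- The bound on `b` localizes both variables: one copy of the indicator of `K` cuts `u` off, so no
decay of `u` is needed, and the other makes the integral over the free variable finite. -/
lemma IsBddCompact.memLp_mul_fst {b : E n × E n → ℝ} (hb : IsBddCompact b) {u : E n → ℝ}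
    (hu : LocL2 u) : MemLp (fun p : E n × E n => b p * u p.1) 2 volume := by
  obtain ⟨M, K, hK, h⟩ := hb.bound
  have h1 : MemLp (K.indicator u) 2 volume :=
    (memLp_indicator_iff_restrict hK.measurableSet).2 (hu.memLp K hK)
  have h2 : MemLp (K.indicator (1 : E n → ℝ)) 2 volume :=
    memLp_indicator_const 2 hK.measurableSet 1 (Or.inr hK.measure_lt_top.ne)
  refine (memLp_two_mul_prod h1 h2).of_le_mul (c := M)
    (hb.measurable.aestronglyMeasurable.mul hu.meas.comp_fst) (ae_of_all _ fun p => ?_)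
  have := mul_le_mul_of_nonneg_right (h p) (abs_nonneg (u p.1))
  simp only [norm_mul, Real.norm_eq_abs]
  refine this.trans (le_of_eq ?_)
  by_cases h1 : p.1 ∈ K <;> by_cases h2 : p.2 ∈ K <;> simp [h1, h2]

lemma IsBddCompact.memLp_mul_snd {b : E n × E n → ℝ} (hb : IsBddCompact b) {u : E n → ℝ}
    (hu : LocL2 u) : MemLp (fun p : E n × E n => b p * u p.2) 2 volume := by
  simpa using memLp_swap (hb.comp_swap.memLp_mul_fst hu)

/-! ### The Gagliardo quotient -/

/-- The weight of the Gagliardo quotient. -/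
def kappa (s : ℝ) (p : E n × E n) : ℝ := (‖p.1 - p.2‖ ^ ((n : ℝ) / 2 + s))⁻¹

lemma kappa_nonneg (p : E n × E n) : 0 ≤ kappa s p := by unfold kappa; positivity

lemma kappa_pos {p : E n × E n} (h : p.1 ≠ p.2) : 0 < kappa s p := by
  have : 0 < ‖p.1 - p.2‖ := norm_pos_iff.2 (sub_ne_zero.2 h)
  unfold kappa; positivity

lemma kappa_swap (p : E n × E n) : kappa s p.swap = kappa s p := by
  simp [kappa, norm_sub_rev]

@[fun_prop]
lemma measurable_kappa : Measurable (kappa (n := n) s) := by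
  unfold kappa; fun_prop

lemma gagliardoQuotient_apply (u : E n → ℝ) (p : E n × E n) :
    gagliardoQuotient s u p = kappa s p * (u p.1 - u p.2) := by
  simp [gagliardoQuotient, kappa]

lemma gagliardoQuotient_swap (u : E n → ℝ) (p : E n × E n) :
    gagliardoQuotient s u p.swap = - gagliardoQuotient s u p := by
  simp only [gagliardoQuotient_apply, kappa_swap, Prod.fst_swap, Prod.snd_swap]; ring

lemma gagliardoQuotient_sub (u v : E n → ℝ) :
    gagliardoQuotient s (u - v) = gagliardoQuotient s u - gagliardoQuotient s v := by
  ext p; simp only [gagliardoQuotient_apply, Pi.sub_apply]; ring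

lemma gagliardoQuotient_add (u v : E n → ℝ) :
    gagliardoQuotient s (u + v) = gagliardoQuotient s u + gagliardoQuotient s v := by
  ext p; simp only [gagliardoQuotient_apply, Pi.add_apply]; ring

/-- The two factors are evaluated at different points. This asymmetric Leibniz rule is exact, and
every term is a function of one variable times a quotient. -/
lemma gagliardoQuotient_mul (u v : E n → ℝ) (p : E n × E n) :
    gagliardoQuotient s (u * v) p =
      u p.1 * gagliardoQuotient s v p + v p.2 * gagliardoQuotient s u p := by
  simp only [gagliardoQuotient_apply, Pi.mul_apply]; ring

lemma aestronglyMeasurable_gagliardoQuotient {u : E n → ℝ} (hu : AEStronglyMeasurable u volume) :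
    AEStronglyMeasurable (gagliardoQuotient s u) volume := by
  have h : gagliardoQuotient s u = fun p => kappa s p * (u p.1 - u p.2) :=
    funext (gagliardoQuotient_apply u)
  rw [h]
  exact measurable_kappa.aestronglyMeasurable.mul (hu.comp_fst.sub hu.comp_snd)

lemma gagliardoQuotient_congr_ae {u v : E n → ℝ} (h : u =ᵐ[volume] v) :
    gagliardoQuotient s u =ᵐ[volume] gagliardoQuotient s v := by
  have h1 : ∀ᵐ p : E n × E n, u p.1 = v p.1 := Measure.quasiMeasurePreserving_fst.ae h
  have h2 : ∀ᵐ p : E n × E n, u p.2 = v p.2 := Measure.quasiMeasurePreserving_snd.ae h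
  filter_upwards [h1, h2] with p h1 h2
  simp only [gagliardoQuotient_apply, h1, h2]

lemma sobolevNorm_congr_ae {u v : E n → ℝ} (h : u =ᵐ[volume] v) :
    sobolevNorm s u = sobolevNorm s v := by
  unfold sobolevNorm
  rw [eLpNorm_congr_ae h, eLpNorm_congr_ae (gagliardoQuotient_congr_ae h)]

lemma memSobolev_iff {u : E n → ℝ} :
    MemSobolev s u ↔ MemLp u 2 volume ∧ MemLp (gagliardoQuotient s u) 2 volume := by
  unfold MemSobolev sobolevNorm MemLp
  rw [ENNReal.add_lt_top]
  constructor
  · rintro ⟨h, h1, h2⟩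
    exact ⟨⟨h, h1⟩, aestronglyMeasurable_gagliardoQuotient h, h2⟩
  · rintro ⟨⟨h, h1⟩, _, h2⟩
    exact ⟨h, h1, h2⟩

lemma MemSobolev.memLp {u : E n → ℝ} (h : MemSobolev s u) : MemLp u 2 volume :=
  (memSobolev_iff.1 h).1

lemma MemSobolev.memLp_gagliardo {u : E n → ℝ} (h : MemSobolev s u) :
    MemLp (gagliardoQuotient s u) 2 volume :=
  (memSobolev_iff.1 h).2

lemma MemSobolev.add {u v : E n → ℝ} (hu : MemSobolev s u) (hv : MemSobolev s v) :
    MemSobolev s (u + v) := by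
  rw [memSobolev_iff, gagliardoQuotient_add]
  exact ⟨hu.memLp.add hv.memLp, hu.memLp_gagliardo.add hv.memLp_gagliardo⟩

lemma MemSobolev.sub {u v : E n → ℝ} (hu : MemSobolev s u) (hv : MemSobolev s v) :
    MemSobolev s (u - v) := by
  rw [memSobolev_iff, gagliardoQuotient_sub]
  exact ⟨hu.memLp.sub hv.memLp, hu.memLp_gagliardo.sub hv.memLp_gagliardo⟩

lemma MemSobolev.congr_ae {u v : E n → ℝ} (hu : MemSobolev s u) (h : u =ᵐ[volume] v) :
    MemSobolev s v :=
  ⟨hu.1.congr h, sobolevNorm_congr_ae (s := s) h ▸ hu.2⟩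

lemma sobolevNorm_add_le {u v : E n → ℝ} (hu : AEStronglyMeasurable u volume)
    (hv : AEStronglyMeasurable v volume) :
    sobolevNorm s (u + v) ≤ sobolevNorm s u + sobolevNorm s v := by
  unfold sobolevNorm
  rw [gagliardoQuotient_add]
  refine (add_le_add (eLpNorm_add_le hu hv one_le_two) (eLpNorm_add_le
    (aestronglyMeasurable_gagliardoQuotient hu) (aestronglyMeasurable_gagliardoQuotient hv)
    one_le_two)).trans (le_of_eq ?_)
  abel

/-! ### Multiplication by bounded Lipschitz functions -/

/-- In polar coordinates the square behaves like r^(1-2s) near zero, integrable because s < 1, and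
like r^(-1-2s) at infinity, integrable because s > 0. -/
lemma memLp_two_min_norm (hs0 : 0 < s) (hs1 : s < 1) {L M : ℝ} (hL : 0 ≤ L) (hM : 0 ≤ M) :
    MemLp (fun z : E n => (‖z‖ ^ ((n : ℝ) / 2 + s))⁻¹ * min (L * ‖z‖) M) 2 volume := by
  refine (memLp_two_iff_integrable_sq (by fun_prop)).2 ?_
  rcases Nat.eq_zero_or_pos n with rfl | hn
  · have : Subsingleton (E 0) := inferInstance
    exact .of_finite
  have : Nonempty (Fin n) := ⟨⟨0, hn⟩⟩
  have : Nontrivial (E n) := inferInstance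
  rw [integrable_fun_norm_addHaar volume
    (f := fun r : ℝ => ((r ^ ((n : ℝ) / 2 + s))⁻¹ * min (L * r) M) ^ 2)]
  have hmeas : Measurable (fun y : ℝ => y ^ (Module.finrank ℝ (E n) - 1) •
      ((y ^ ((n : ℝ) / 2 + s))⁻¹ * min (L * y) M) ^ 2) := by fun_prop
  have key : ∀ y : ℝ, 0 < y → y ^ (Module.finrank ℝ (E n) - 1) •
      ((y ^ ((n : ℝ) / 2 + s))⁻¹ * min (L * y) M) ^ 2 =
        y ^ (-1 - 2 * s) * (min (L * y) M) ^ 2 := by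
    intro y hy
    have h1 : y ^ (n - 1) = y ^ ((n : ℝ) - 1) := by
      rw [← Real.rpow_natCast, Nat.cast_sub hn]; simp
    have h2 : ((y ^ ((n : ℝ) / 2 + s))⁻¹) ^ 2 = y ^ (-(n + 2 * s) : ℝ) := by
      rw [← Real.rpow_neg hy.le, ← Real.rpow_natCast, ← Real.rpow_mul hy.le]
      congr 1; push_cast; ring
    rw [finrank_euclideanSpace_fin, smul_eq_mul, mul_pow, h1, h2, ← mul_assoc,
      ← Real.rpow_add hy]
    congr 2; ring
  have hsplit : Ioi (0 : ℝ) = Ioo 0 1 ∪ Ici 1 := by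
    ext x; simp only [mem_Ioi, mem_union, mem_Ioo, mem_Ici]
    constructor
    · intro h; rcases lt_or_ge x 1 with h1 | h1 <;> simp [h, h1]
    · rintro (h | h) <;> linarith
  rw [hsplit]
  have hmin : ∀ y : ℝ, 0 < y → 0 ≤ min (L * y) M := fun y hy => le_min (by positivity) hM
  refine IntegrableOn.union ?_ ?_
  · have h1 : IntegrableOn (fun y : ℝ => L ^ 2 * y ^ (1 - 2 * s)) (Ioo 0 1) :=
      ((intervalIntegral.integrableOn_Ioo_rpow_iff one_pos).2 (by linarith)).const_mul _
    refine Integrable.mono' h1 hmeas.aestronglyMeasurable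
      ((ae_restrict_iff' measurableSet_Ioo).2 (ae_of_all _ fun y hy => ?_))
    have hy0 := hy.1
    have h2 : y ^ (1 - 2 * s) = y ^ (-1 - 2 * s) * y ^ 2 := by
      rw [← Real.rpow_natCast, ← Real.rpow_add hy0]; congr 1; push_cast; ring
    rw [key y hy0, Real.norm_of_nonneg (by positivity), h2]
    calc y ^ (-1 - 2 * s) * (min (L * y) M) ^ 2 ≤ y ^ (-1 - 2 * s) * (L * y) ^ 2 := by
          gcongr
          exact min_le_left _ _
      _ = _ := by ring
  · have h1 : IntegrableOn (fun y : ℝ => y ^ (-1 - 2 * s) * M ^ 2) (Ici 1) :=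
      ((integrableOn_Ici_iff_integrableOn_Ioi).2
        (integrableOn_Ioi_rpow_of_lt (by linarith) one_pos)).mul_const _
    refine Integrable.mono' h1 hmeas.aestronglyMeasurable
      ((ae_restrict_iff' measurableSet_Ici).2 (ae_of_all _ fun y hy => ?_))
    have hy0 : 0 < y := one_pos.trans_le hy
    rw [key y hy0, Real.norm_of_nonneg (by positivity)]
    gcongr
    exact min_le_right _ _

/-- The measure-preserving change of variables (x,y) ↦ (x-y,y) turns the bound on the quotient of
`χ` into the tensor product of the kernel in `memLp_two_min_norm` and `f`. -/
lemma memLp_two_mul_gagliardo_lipschitz (hs0 : 0 < s) (hs1 : s < 1) {f χ : E n → ℝ} {L M : ℝ}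
    (hf : MemLp f 2 volume) (hχ : AEStronglyMeasurable χ volume)
    (hL : ∀ x y, |χ x - χ y| ≤ L * ‖x - y‖) (hM : ∀ x, |χ x| ≤ M) :
    MemLp (fun p : E n × E n => f p.2 * gagliardoQuotient s χ p) 2 volume := by
  have hM0 : 0 ≤ M := (abs_nonneg _).trans (hM 0)
  have h1 := memLp_two_mul_prod (memLp_two_min_norm (n := n) hs0 hs1 (abs_nonneg L)
    (add_nonneg hM0 hM0)) hf
  have h2 := h1.comp_measurePreserving (measurePreserving_sub_prod (volume : Measure (E n)) volume)
  refine h2.mono (hf.1.comp_snd.mul (aestronglyMeasurable_gagliardoQuotient hχ))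
    (ae_of_all _ fun p => ?_)
  have h3 : |χ p.1 - χ p.2| ≤ min (|L| * ‖p.1 - p.2‖) (M + M) :=
    le_min ((hL _ _).trans (by gcongr; exact le_abs_self L))
      ((abs_sub _ _).trans (add_le_add (hM _) (hM _)))
  simp only [gagliardoQuotient_apply, Function.comp_apply, norm_mul, Real.norm_eq_abs]
  rw [mul_comm |f p.2|]
  have h4 : |χ p.1 - χ p.2| ≤ |min (|L| * ‖p.1 - p.2‖) (M + M)| := h3.trans (le_abs_self _)
  exact mul_le_mul_of_nonneg_right (mul_le_mul_of_nonneg_left h4 (abs_nonneg _)) (abs_nonneg _)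

lemma MemSobolev.mul_lipschitz (hs0 : 0 < s) (hs1 : s < 1) {f χ : E n → ℝ} {L M : ℝ}
    (hf : MemSobolev s f) (hχ : AEStronglyMeasurable χ volume)
    (hL : ∀ x y, |χ x - χ y| ≤ L * ‖x - y‖) (hM : ∀ x, |χ x| ≤ M) :
    MemSobolev s (χ * f) := by
  refine memSobolev_iff.2 ⟨hf.memLp.of_le_mul (c := M) (hχ.mul hf.1) (ae_of_all _ fun x => ?_), ?_⟩
  · simpa using mul_le_mul_of_nonneg_right (hM x) (abs_nonneg (f x))
  · have h1 := memLp_two_mul_gagliardo_lipschitz hs0 hs1 hf.memLp hχ hL hM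
    have h2 : MemLp (fun p : E n × E n => χ p.1 * gagliardoQuotient s f p) 2 volume :=
      hf.memLp_gagliardo.of_le_mul (c := M) (hχ.comp_fst.mul hf.memLp_gagliardo.1)
        (ae_of_all _ fun p => by
          simpa using mul_le_mul_of_nonneg_right (hM p.1) (abs_nonneg (gagliardoQuotient s f p)))
    exact (h2.add h1).ae_eq (ae_of_all _ fun p => (gagliardoQuotient_mul χ f p).symm)

/-- A Lipschitz function with compact support belongs to `H^s`. -/
lemma memSobolev_of_lipschitz (hs0 : 0 < s) (hs1 : s < 1) {χ : E n → ℝ} {L : ℝ}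
    (hc : Continuous χ) (hK : HasCompactSupport χ) (hL : ∀ x y, |χ x - χ y| ≤ L * ‖x - y‖) :
    MemSobolev s χ := by
  obtain ⟨M, hM⟩ := hK.exists_bound_of_continuous hc
  simp only [Real.norm_eq_abs] at hM
  have hχ : AEStronglyMeasurable χ volume := hc.aestronglyMeasurable
  have hKm : MeasurableSet (tsupport χ) := (isClosed_tsupport χ).measurableSet
  have h1 : MemLp ((tsupport χ).indicator (1 : E n → ℝ)) 2 volume :=
    memLp_indicator_const 2 hKm 1 (Or.inr hK.measure_lt_top.ne)
  have h2 := memLp_two_mul_gagliardo_lipschitz hs0 hs1 h1 hχ hL hM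
  refine memSobolev_iff.2 ⟨hc.memLp_of_hasCompactSupport hK, ?_⟩
  -- The quotient vanishes unless one of the two points lies in the support; `h2` covers the case of
  -- the second point and its swap the case of the first.
  refine (h2.norm.add (memLp_swap h2.norm)).mono (aestronglyMeasurable_gagliardoQuotient hχ)
    (ae_of_all _ fun p => ?_)
  simp only [Pi.add_apply, gagliardoQuotient_swap, Prod.snd_swap, norm_mul, norm_neg]
  rw [← add_mul, norm_mul, norm_norm]
  by_cases hp : p.1 ∈ tsupport χ
  · refine le_mul_of_one_le_left (norm_nonneg _) ?_
    rw [Real.norm_of_nonneg (by positivity)]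
    simp [hp]
  by_cases hp2 : p.2 ∈ tsupport χ
  · refine le_mul_of_one_le_left (norm_nonneg _) ?_
    rw [Real.norm_of_nonneg (by positivity)]
    simp [hp2]
  · simp [gagliardoQuotient_apply, image_eq_zero_of_notMem_tsupport hp,
      image_eq_zero_of_notMem_tsupport hp2]

lemma IsTestFunction.exists_lipschitz {U : Set (E n)} {ψ : E n → ℝ} (h : IsTestFunction U ψ) :
    ∃ L : ℝ, ∀ x y, |ψ x - ψ y| ≤ L * ‖x - y‖ := by
  obtain ⟨C, hC⟩ := h.1.lipschitzWith_of_hasCompactSupport h.2.1 (by simp)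
  exact ⟨C, fun x y => by simpa [Real.dist_eq, dist_eq_norm] using hC.dist_le_mul x y⟩

lemma IsTestFunction.memSobolev (hs0 : 0 < s) (hs1 : s < 1) {U : Set (E n)} {ψ : E n → ℝ}
    (h : IsTestFunction U ψ) : MemSobolev s ψ := by
  obtain ⟨L, hL⟩ := h.exists_lipschitz
  exact memSobolev_of_lipschitz hs0 hs1 h.1.continuous h.2.1 hL

/-! ### Translations and mollification in `H^s` -/

/-- This is the continuity of the translation action on L², read off from the action of `DomAddAct`
on `Lp`. -/
lemma tendsto_eLpNorm_sub_translate {X : Type*} [NormedAddCommGroup X] [NormedSpace ℝ X]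
    [FiniteDimensional ℝ X] [MeasurableSpace X] [BorelSpace X] {μ : Measure X} [μ.IsAddHaarMeasure]
    {f : X → ℝ} (hf : MemLp f 2 μ) :
    Filter.Tendsto (fun h : X => eLpNorm (fun x => f x - f (x - h)) 2 μ) (nhds 0) (nhds 0) := by
  have : Fact ((2 : ENNReal) ≠ ⊤) := ⟨by simp⟩
  set F : Lp ℝ 2 μ := hf.toLp f
  have hc : Continuous fun h : X => edist F (DomAddAct.mk (-h) +ᵥ F) := by fun_prop
  have h0 := hc.tendsto 0
  have hz : edist F (DomAddAct.mk (-(0 : X)) +ᵥ F) = 0 := by simp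
  rw [hz] at h0
  refine h0.congr fun h => ?_
  rw [DomAddAct.mk_vadd_toLp, Lp.edist_toLp_toLp]
  refine eLpNorm_congr_ae (ae_of_all _ fun x => ?_)
  simp [sub_eq_add_neg, add_comm]

lemma eLpNorm_two_sq {X : Type*} [MeasurableSpace X] (μ : Measure X) (h : X → ℝ) :
    (eLpNorm h 2 μ) ^ 2 = ∫⁻ x, ‖h x‖ₑ ^ 2 ∂μ := by
  rw [eLpNorm_eq_lintegral_rpow_enorm_toReal (by simp) (by simp), ← ENNReal.rpow_natCast,
    ← ENNReal.rpow_mul]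
  simp

/-- Minkowski's integral inequality against a probability measure: bound the square of the mean by
the mean of the squares, then apply Tonelli. -/
lemma eLpNorm_two_integral_le {X Y : Type*} [MeasurableSpace X] [MeasurableSpace Y]
    {μ : Measure X} [SFinite μ] {ν : Measure Y} [IsProbabilityMeasure ν] {g : X → Y → ℝ}
    (hg : Measurable (Function.uncurry g)) {C : ENNReal}
    (hC : ∀ᵐ y ∂ν, eLpNorm (fun x => g x y) 2 μ ≤ C) :
    eLpNorm (fun x => ∫ y, g x y ∂ν) 2 μ ≤ C := by
  rw [← ENNReal.pow_le_pow_left_iff (two_ne_zero), eLpNorm_two_sq]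
  calc ∫⁻ x, ‖∫ y, g x y ∂ν‖ₑ ^ 2 ∂μ ≤ ∫⁻ x, ∫⁻ y, ‖g x y‖ₑ ^ 2 ∂ν ∂μ := by
        refine lintegral_mono fun x => ?_
        rw [← eLpNorm_two_sq]
        have hm : AEStronglyMeasurable (g x) ν := (hg.of_uncurry_left).aestronglyMeasurable
        gcongr
        refine (enorm_integral_le_lintegral_enorm _).trans ?_
        rw [← eLpNorm_one_eq_lintegral_enorm]
        exact eLpNorm_le_eLpNorm_of_exponent_le one_le_two hm
    _ = ∫⁻ y, ∫⁻ x, ‖g x y‖ₑ ^ 2 ∂μ ∂ν :=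
        lintegral_lintegral_swap (hg.enorm.pow_const 2).aemeasurable
    _ ≤ ∫⁻ _, C ^ 2 ∂ν := by
        refine lintegral_mono_ae ?_
        filter_upwards [hC] with y hy
        rw [← eLpNorm_two_sq]
        gcongr
    _ = C ^ 2 := by simp

/-- Convolution with a normalized bump function whose support is close to the origin is close to
the identity in `H^s`. -/
lemma exists_sobolevNorm_sub_convolution_le {f : E n → ℝ} (hfm : Measurable f)
    (hf : MemSobolev s f) {ε : ENNReal} (hε : 0 < ε) :
    ∃ r > 0, ∀ (c : E n) (φ : ContDiffBump c), ‖c‖ + φ.rOut < r →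
      sobolevNorm s (f - convolution (φ.normed volume) f (ContinuousLinearMap.lsmul ℝ ℝ) volume)
        ≤ ε := by
  have hε2 : 0 < ε / 2 := ENNReal.half_pos hε.ne'
  have hGm : Measurable (gagliardoQuotient s f) := by
    have h : gagliardoQuotient s f = fun p => kappa s p * (f p.1 - f p.2) :=
      funext (gagliardoQuotient_apply f)
    rw [h]; fun_prop
  have T1 := (tendsto_eLpNorm_sub_translate hf.memLp).eventually (Iic_mem_nhds hε2)
  have : (volume : Measure (E n × E n)).IsAddHaarMeasure :=
    inferInstanceAs ((volume.prod volume).IsAddHaarMeasure)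
  -- The weight depends only on x - y, so translating `f` by h translates its quotient by (h,h). L²
  -- continuity on the product space therefore also controls the seminorm.
  have T2 := (tendsto_eLpNorm_sub_translate hf.memLp_gagliardo).eventually (Iic_mem_nhds hε2)
  have T3 : Filter.Tendsto (fun h : E n => (h, h)) (nhds 0) (nhds (0 : E n × E n)) :=
    (continuous_id.prodMk continuous_id).tendsto' 0 _ rfl
  obtain ⟨r, hr, hT⟩ := Metric.eventually_nhds_iff.1 (T1.and (T3.eventually T2))
  refine ⟨r, hr, fun c φ hc => ?_⟩
  set ρ : E n → ℝ := φ.normed volume with hρ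
  have hρ0 : ∀ x, 0 ≤ ρ x := φ.nonneg_normed
  have hρi : Integrable ρ volume := φ.integrable_normed
  -- Viewing the mollifier as a probability measure makes `f` minus its mollification an average of
  -- f - f(· - h), to which Minkowski's inequality applies.
  set ν : Measure (E n) := volume.withDensity (fun h => ENNReal.ofReal (ρ h)) with hν
  have hρm : Measurable (fun h => ENNReal.ofReal (ρ h)) :=
    (φ.continuous_normed.measurable).ennreal_ofReal
  have hprob : IsProbabilityMeasure ν := by
    refine ⟨?_⟩
    rw [hν, withDensity_apply _ MeasurableSet.univ, Measure.restrict_univ,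
      ← ofReal_integral_eq_lintegral_ofReal hρi (ae_of_all _ hρ0), φ.integral_normed,
      ENNReal.ofReal_one]
  have hconv : ∀ g : E n → ℝ, ∫ h, g h ∂ν = ∫ h, ρ h * g h := by
    intro g
    rw [hν, integral_withDensity_eq_integral_toReal_smul hρm (by simp)]
    simp [ENNReal.toReal_ofReal (hρ0 _)]
  have hint : ∀ x : E n, Integrable (fun h => f (x - h)) ν := by
    intro x
    rw [hν, integrable_withDensity_iff_integrable_smul' hρm (by simp)]
    have hl : LocallyIntegrable (fun h => f (x - h)) volume :=
      (hf.memLp.comp_measurePreserving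
        (Measure.measurePreserving_sub_left volume x)).locallyIntegrable one_le_two
    have := hl.integrable_smul_left_of_hasCompactSupport (g := ρ) φ.continuous_normed
      φ.hasCompactSupport_normed
    refine this.congr (ae_of_all _ fun h => ?_)
    simp only [ENNReal.toReal_ofReal (hρ0 _)]
  set ψ := convolution ρ f (ContinuousLinearMap.lsmul ℝ ℝ) volume with hψ
  have hψx : ∀ x, ψ x = ∫ h, f (x - h) ∂ν := by
    intro x; rw [hconv]; rfl
  have hae : ∀ᵐ h ∂ν, dist h 0 < r := by
    rw [hν, ae_withDensity_iff hρm]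
    refine ae_of_all _ fun h hh => ?_
    have h1 : ρ h ≠ 0 := by
      intro h0; simp [h0] at hh
    have h2 : h ∈ Function.support (φ.normed volume) := h1
    rw [φ.support_normed_eq, Metric.mem_ball] at h2
    calc dist h 0 ≤ dist h c + dist c 0 := dist_triangle _ _ _
      _ < r := by rw [dist_zero_right]; linarith
  have hfψ : f - ψ = fun x => ∫ h, (f x - f (x - h)) ∂ν := by
    ext x
    rw [integral_sub (integrable_const _) (hint x), Pi.sub_apply, hψx]
    simp
  have hGψ : gagliardoQuotient s (f - ψ) = fun p => ∫ h, (gagliardoQuotient s f p -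
      gagliardoQuotient s f (p - (h, h))) ∂ν := by
    ext p
    have e : ∀ h : E n, gagliardoQuotient s f p - gagliardoQuotient s f (p - (h, h)) =
        kappa s p * ((f p.1 - f (p.1 - h)) - (f p.2 - f (p.2 - h))) := by
      intro h
      simp only [gagliardoQuotient_apply, kappa, Prod.fst_sub, Prod.snd_sub, sub_sub_sub_cancel_right]
      ring
    simp only [e]
    have hi : ∀ x : E n, Integrable (fun h => f x - f (x - h)) ν := fun x =>
      (integrable_const _).sub (hint x)
    rw [integral_const_mul, integral_sub (hi p.1) (hi p.2), gagliardoQuotient_apply, hfψ]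
  rw [sobolevNorm, ← ENNReal.add_halves ε]
  refine add_le_add ?_ ?_
  · rw [hfψ]
    refine eLpNorm_two_integral_le (g := fun x h => f x - f (x - h)) ?_ ?_
    · exact (hfm.comp measurable_fst).sub (hfm.comp (measurable_fst.sub measurable_snd))
    · filter_upwards [hae] with h hh using (hT hh).1
  · rw [hGψ]
    refine eLpNorm_two_integral_le
      (g := fun (p : E n × E n) h => gagliardoQuotient s f p - gagliardoQuotient s f (p - (h, h)))
      ?_ ?_
    · exact (hGm.comp measurable_fst).sub (hGm.comp (by fun_prop))
    · filter_upwards [hae] with h hh using (hT hh).2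

lemma MemSobolevTilde.congr_ae {U : Set (E n)} {φ φ' : E n → ℝ} (h : MemSobolevTilde s U φ)
    (he : φ =ᵐ[volume] φ') : MemSobolevTilde s U φ' := by
  refine ⟨h.1.congr_ae he, fun ε hε => ?_⟩
  obtain ⟨ψ, h1, h2⟩ := h.2 ε hε
  exact ⟨ψ, h1, by rwa [← sobolevNorm_congr_ae (he.sub (ae_eq_refl ψ))]⟩

lemma memSobolevTilde_zero (U : Set (E n)) : MemSobolevTilde s U (0 : E n → ℝ) := by
  have hG : gagliardoQuotient s (0 : E n → ℝ) = 0 := by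
    ext p; simp [gagliardoQuotient_apply]
  refine ⟨memSobolev_iff.2 ⟨MemLp.zero, hG ▸ MemLp.zero⟩, fun ε hε => ⟨0, ?_, ?_⟩⟩
  · exact ⟨contDiff_const, HasCompactSupport.zero, by simp⟩
  · simpa [sobolevNorm, hG] using hε

lemma IsTestFunction.add {U : Set (E n)} {φ ψ : E n → ℝ} (hφ : IsTestFunction U φ)
    (hψ : IsTestFunction U ψ) : IsTestFunction U (φ + ψ) :=
  ⟨hφ.1.add hψ.1, hφ.2.1.add hψ.2.1,
    (tsupport_add φ ψ).trans (union_subset hφ.2.2 hψ.2.2)⟩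

lemma MemSobolevTilde.add {U : Set (E n)} {φ φ' : E n → ℝ} (h : MemSobolevTilde s U φ)
    (h' : MemSobolevTilde s U φ') : MemSobolevTilde s U (φ + φ') := by
  refine ⟨h.1.add h'.1, fun ε hε => ?_⟩
  obtain ⟨ψ, h1, h2⟩ := h.2 (ε / 2) (ENNReal.half_pos hε.ne')
  obtain ⟨ψ', h1', h2'⟩ := h'.2 (ε / 2) (ENNReal.half_pos hε.ne')
  refine ⟨ψ + ψ', h1.add h1', ?_⟩
  rw [add_sub_add_comm]
  refine (sobolevNorm_add_le (h.1.1.sub h1.1.continuous.aestronglyMeasurable)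
    (h'.1.1.sub h1'.1.continuous.aestronglyMeasurable)).trans_lt ?_
  rw [← ENNReal.add_halves ε]
  exact ENNReal.add_lt_add h2 h2'

lemma memSobolevTilde_sum {U : Set (E n)} {ι : Type*} (t : Finset ι) {f : ι → E n → ℝ}
    (h : ∀ i ∈ t, MemSobolevTilde s U (f i)) : MemSobolevTilde s U (∑ i ∈ t, f i) :=
  Finset.sum_induction _ (MemSobolevTilde s U) (fun _ _ => MemSobolevTilde.add)
    (memSobolevTilde_zero U) h

/-- A function of class `H^s` which vanishes off a compact set `K` belongs to `H̃^s(U)` if small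
translates of `K` in some direction are contained in `U`. -/
lemma memSobolevTilde_of_translate {U K : Set (E n)} (hU : IsOpen U) (hK : IsCompact K)
    {f : E n → ℝ} (hf : MemSobolev s f) (hfK : ∀ x ∉ K, f x = 0) {v : E n}
    (hv : ∀ᶠ t : ℝ in nhdsWithin 0 (Ioi 0), ∀ y ∈ K, y + t • v ∈ U) : MemSobolevTilde s U f := by
  wlog hfm : Measurable f generalizing f
  · have he : f =ᵐ[volume] K.indicator (hf.1.mk f) := by
      filter_upwards [hf.1.ae_eq_mk] with x hx
      by_cases h : x ∈ K <;> simp [h, hfK, ← hx]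
    refine (this (hf.congr_ae he) (fun x hx => by simp [hx]) ?_).congr_ae he.symm
    exact hf.1.stronglyMeasurable_mk.measurable.indicator hK.measurableSet
  refine ⟨hf, fun ε hε => ?_⟩
  obtain ⟨ε', hε', hlt⟩ := exists_between hε
  obtain ⟨r, hr, H⟩ := exists_sobolevNorm_sub_convolution_le hfm hf hε'
  have hcont : Filter.Tendsto (fun t : ℝ => ‖t • v‖) (nhdsWithin 0 (Ioi 0)) (nhds 0) := by
    have : Continuous fun t : ℝ => ‖t • v‖ := by fun_prop
    exact (this.tendsto' 0 0 (by simp)).mono_left nhdsWithin_le_nhds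
  obtain ⟨t, ht, htr⟩ := (hv.and (hcont.eventually (Iio_mem_nhds (half_pos hr)))).exists
  have hK' : IsCompact ((fun y => y + t • v) '' K) := hK.image (by fun_prop)
  obtain ⟨δ, hδ, hsub⟩ := hK'.exists_cthickening_subset_open hU (by rintro _ ⟨y, hy, rfl⟩; exact ht y hy)
  -- Centring the bump at t • v rather than at the origin performs the inward push and the smoothing
  -- in a single convolution.
  let φ : ContDiffBump (t • v) := ⟨min δ (r / 2) / 2, min δ (r / 2), by positivity,
    half_lt_self (by positivity)⟩
  have hφ : φ.rOut = min δ (r / 2) := rfl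
  have hsupp : Function.support
      (convolution (φ.normed volume) f (ContinuousLinearMap.lsmul ℝ ℝ) volume) ⊆
      Metric.cthickening δ ((fun y => y + t • v) '' K) := by
    refine (support_convolution_subset _).trans ?_
    rintro _ ⟨a, ha, b, hb, rfl⟩
    rw [φ.support_normed_eq, Metric.mem_ball, hφ] at ha
    have hbK : b ∈ K := by by_contra h; exact hb (hfK b h)
    refine Metric.mem_cthickening_of_dist_le _ (b + t • v) δ _ ⟨b, hbK, rfl⟩ ?_
    rw [add_comm b, dist_add_right]
    exact ha.le.trans (min_le_left _ _)
  have hts := closure_minimal hsupp Metric.isClosed_cthickening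
  refine ⟨_, ⟨?_, ?_, hts.trans hsub⟩, (H _ φ ?_).trans_lt hlt⟩
  · exact φ.hasCompactSupport_normed.contDiff_convolution_left _ φ.contDiff_normed
      (hf.memLp.locallyIntegrable one_le_two)
  · exact HasCompactSupport.of_support_subset_isCompact hK'.cthickening hsupp
  · rw [hφ]
    have := min_le_right δ (r / 2)
    have h2 : ‖t • v‖ < r / 2 := htr
    linarith

/-! ### Lipschitz domains -/

/-- The boundary lies locally in a graph over the hyperplane orthogonal to `e`. The translates of a
graph by 1/(k+1) along `e` are pairwise disjoint with bounded shifts, so the graph is null. -/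
lemma IsLipschitzDomain.volume_frontier {U : Set (E n)} (hU : IsLipschitzDomain U) :
    volume (frontier U) = 0 := by
  refine measure_null_of_locally_null _ fun p hp => ?_
  obtain ⟨e, r, γ, K, he, hr, hγ, H⟩ := hU.2 p hp
  refine ⟨frontier U ∩ Metric.ball p r,
    Filter.inter_mem self_mem_nhdsWithin
      (mem_nhdsWithin_of_mem_nhds (Metric.ball_mem_nhds p hr)), ?_⟩
  have hee : ⟪e, e⟫_ℝ = 1 := by rw [real_inner_self_eq_norm_sq, he]; norm_num
  have hγc : Continuous fun y : E n => γ (y - ⟪e, y⟫_ℝ • e) := hγ.continuous.comp (by fun_prop)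
  have hec : Continuous fun y : E n => ⟪e, y⟫_ℝ := by fun_prop
  set S : Set (E n) := {y | γ (y - ⟪e, y⟫_ℝ • e) = ⟪e, y⟫_ℝ} with hS
  have hsub : frontier U ∩ Metric.ball p r ⊆ S := by
    rintro y ⟨hyf, hyb⟩
    rw [hU.1.frontier_eq] at hyf
    refine le_antisymm ?_ (not_lt.1 fun h => hyf.2 ((H y hyb).2 h))
    by_contra! h
    obtain ⟨z, hz, hzU⟩ := mem_closure_iff.1 hyf.1 _
      ((isOpen_lt hec hγc).inter Metric.isOpen_ball) ⟨h, hyb⟩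
    exact lt_asymm hz.1 ((H z hz.2).1 hzU)
  refine measure_mono_null hsub ?_
  have hSm : MeasurableSet S := (isClosed_eq hγc hec).measurableSet
  refine Measure.addHaar_eq_zero_of_disjoint_translates volume
    (fun k : ℕ => ((1 : ℝ) / (k + 1)) • e) ?_ ?_ hSm
  · refine (Metric.isBounded_closedBall (x := (0 : E n)) (r := 1)).subset ?_
    rintro _ ⟨k, rfl⟩
    rw [mem_closedBall_zero_iff, norm_smul, he, mul_one, Real.norm_of_nonneg (by positivity)]
    exact (div_le_one (by positivity)).2 (by linarith [(Nat.cast_nonneg k : (0 : ℝ) ≤ k)])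
  · intro j k hjk
    rw [Function.onFun, Set.disjoint_left]
    rintro _ ⟨_, rfl, y, hy, rfl⟩ ⟨_, rfl, z, hz, hyz⟩
    have hzy : z = y + ((1 : ℝ) / (j + 1) - 1 / (k + 1)) • e := by
      rw [sub_smul]
      have : ((1 : ℝ) / (k + 1)) • e + z = ((1 : ℝ) / (j + 1)) • e + y := hyz
      rw [← add_sub_assoc, add_comm y, ← this]; abel
    have hz' : γ (z - ⟪e, z⟫_ℝ • e) = ⟪e, z⟫_ℝ := hz
    have hy' : γ (y - ⟪e, y⟫_ℝ • e) = ⟪e, y⟫_ℝ := hy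
    have h1 : ⟪e, z⟫_ℝ = ⟪e, y⟫_ℝ + ((1 : ℝ) / (j + 1) - 1 / (k + 1)) := by
      rw [hzy, inner_add_right, inner_smul_right, hee, mul_one]
    have h2 : z - ⟪e, z⟫_ℝ • e = y - ⟪e, y⟫_ℝ • e := by
      rw [h1, hzy, add_smul]; abel
    rw [h2, hy', h1] at hz'
    have h3 : (1 : ℝ) / (j + 1) = 1 / (k + 1) := by linarith
    rw [div_eq_div_iff (by positivity) (by positivity)] at h3
    exact hjk (by exact_mod_cast (by linarith : (j : ℝ) = k))

/-- Near each point of its closure, a Lipschitz domain can be translated into itself. -/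
lemma IsLipschitzDomain.exists_translate {U : Set (E n)} (hU : IsLipschitzDomain U) {p : E n}
    (hp : p ∈ closure U) : ∃ r > 0, ∃ v : E n, ∀ K ⊆ Metric.ball p r ∩ closure U, IsCompact K →
      ∀ᶠ t : ℝ in nhdsWithin 0 (Ioi 0), ∀ y ∈ K, y + t • v ∈ U := by
  by_cases hpU : p ∈ U
  · obtain ⟨r, hr, hsub⟩ := Metric.isOpen_iff.1 hU.1 p hpU
    refine ⟨r, hr, 0, fun K hK _ => Filter.Eventually.of_forall fun t y hy => ?_⟩
    simpa using hsub (hK hy).1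
  obtain ⟨e, r, γ, L, he, hr, hγ, H⟩ := hU.2 p (hU.1.frontier_eq ▸ ⟨hp, hpU⟩)
  have hee : ⟪e, e⟫_ℝ = 1 := by rw [real_inner_self_eq_norm_sq, he]; norm_num
  have hγc : Continuous fun y : E n => γ (y - ⟪e, y⟫_ℝ • e) := hγ.continuous.comp (by fun_prop)
  have hec : Continuous fun y : E n => ⟪e, y⟫_ℝ := by fun_prop
  refine ⟨r, hr, e, fun K hK hKc => ?_⟩
  -- A compact set keeps a positive distance from the edge of the ball, so small shifts along `e`
  -- stay where the graph description is valid.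
  obtain ⟨δ, hδ, hsub⟩ := hKc.exists_cthickening_subset_open Metric.isOpen_ball
    (hK.trans inter_subset_left)
  filter_upwards [Ioo_mem_nhdsGT hδ] with t ht y hy
  have hball : y + t • e ∈ Metric.ball p r := by
    refine hsub (Metric.mem_cthickening_of_dist_le _ y δ _ hy ?_)
    rw [dist_eq_norm, add_sub_cancel_left, norm_smul, he, mul_one, Real.norm_of_nonneg ht.1.le]
    exact ht.2.le
  rw [H _ hball]
  have h1 : ⟪e, y + t • e⟫_ℝ = ⟪e, y⟫_ℝ + t := by
    rw [inner_add_right, inner_smul_right, hee, mul_one]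
  have h2 : y + t • e - ⟪e, y + t • e⟫_ℝ • e = y - ⟪e, y⟫_ℝ • e := by
    rw [h1, add_smul]; abel
  rw [h2, h1]
  have h3 : γ (y - ⟪e, y⟫_ℝ • e) ≤ ⟪e, y⟫_ℝ := by
    by_contra! h
    obtain ⟨z, hz, hzU⟩ := mem_closure_iff.1 (hK hy).2 _
      ((isOpen_lt hec hγc).inter Metric.isOpen_ball) ⟨h, (hK hy).1⟩
    exact lt_asymm hz.1 ((H z hz.2).1 hzU)
  linarith [ht.1]

open scoped Manifold in
/-- On a bounded Lipschitz domain, `H̃^s(U)` contains the functions in `H^s(ℝⁿ)` that vanish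
outside `U`. -/
theorem IsLipschitzDomain.memSobolevTilde (hs0 : 0 < s) (hs1 : s < 1) {U : Set (E n)}
    (hU : IsLipschitzDomain U) (hUb : Bornology.IsBounded U) {w : E n → ℝ} (hw : MemSobolev s w)
    (hw0 : ∀ x ∉ U, w x = 0) : MemSobolevTilde s U w := by
  have hc : IsCompact (closure U) := hUb.isCompact_closure
  choose! r hr v hv using fun p hp => hU.exists_translate (p := p) hp
  obtain ⟨T, hT⟩ := hc.elim_finite_subcover (fun p : closure U => Metric.ball (p : E n) (r p))
    (fun _ => Metric.isOpen_ball)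
    (fun p hp => mem_iUnion.2 ⟨⟨p, hp⟩, Metric.mem_ball_self (hr p hp)⟩)
  obtain ⟨χ, hχ⟩ := SmoothPartitionOfUnity.exists_isSubordinate 𝓘(ℝ, E n) hc.isClosed
    (fun i : T => Metric.ball ((i : closure U) : E n) (r i)) (fun _ => Metric.isOpen_ball)
    (by
      intro x hx
      obtain ⟨i, hi, hx⟩ := mem_iUnion₂.1 (hT hx)
      exact mem_iUnion.2 ⟨⟨i, hi⟩, hx⟩)
  have hsum : w = ∑ i : T, (χ i : E n → ℝ) * w := by
    ext x
    rw [Finset.sum_apply]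
    simp only [Pi.mul_apply]
    rw [← Finset.sum_mul]
    by_cases hx : x ∈ U
    · have := χ.sum_eq_one (subset_closure hx)
      rw [finsum_eq_sum_of_fintype] at this
      rw [this, one_mul]
    · rw [hw0 x hx, mul_zero]
  rw [hsum]
  refine memSobolevTilde_sum _ fun i _ => ?_
  have hcs : HasCompactSupport (χ i) :=
    HasCompactSupport.of_support_subset_isCompact
      (Metric.isBounded_ball (x := ((i : closure U) : E n)) (r := r i)).isCompact_closure
      ((subset_tsupport _).trans ((hχ i).trans subset_closure))
  have hsm : ContDiff ℝ ∞ (χ i : E n → ℝ) := (χ i).contMDiff.contDiff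
  have hLip := IsTestFunction.exists_lipschitz (U := univ) ⟨hsm, hcs, subset_univ _⟩
  obtain ⟨L, hL⟩ := hLip
  -- Each localized piece lives on a compact set inside one ball, where a single direction `v i`
  -- pushes it into `U`.
  refine memSobolevTilde_of_translate hU.1 (K := tsupport (χ i) ∩ closure U)
    (hcs.isCompact.inter_right isClosed_closure)
    (hw.mul_lipschitz hs0 hs1 hsm.continuous.aestronglyMeasurable hL (M := 1) ?_) ?_
    (hv i (i : closure U).2 _ (inter_subset_inter_left _ (hχ i))
      (hcs.isCompact.inter_right isClosed_closure))
  · intro x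
    rw [abs_of_nonneg (χ.nonneg i x)]
    exact χ.le_one i x
  · intro x hx
    by_cases hxU : x ∈ U
    · have : x ∉ tsupport (χ i) := fun h => hx ⟨h, subset_closure hxU⟩
      simp [image_eq_zero_of_notMem_tsupport this]
    · simp [hw0 x hxU]

/-! ### The magnetic energy -/

/-- The unit vector pointing from `x` to `y` (zero on the diagonal). -/
def dir (p : E n × E n) : E n := ‖p.2 - p.1‖⁻¹ • (p.2 - p.1)

lemma dir_swap (p : E n × E n) : dir p.swap = - dir p := by
  rw [dir, dir, Prod.fst_swap, Prod.snd_swap, norm_sub_rev, ← smul_neg, neg_sub]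

lemma norm_dir_le (p : E n × E n) : ‖dir p‖ ≤ 1 := by
  rw [dir, norm_smul, norm_inv, norm_norm]
  exact inv_mul_le_one

@[fun_prop]
lemma measurable_dir : Measurable (dir (n := n)) := by
  unfold dir; fun_prop

lemma fracGrad_eq (u : E n → ℝ) (p : E n × E n) :
    fracGrad s u p = (√(fracConst n s / 2) * gagliardoQuotient s u p) • dir p := by
  by_cases h : p.1 = p.2
  · simp [fracGrad, dir, h]
  have hn : 0 < ‖p.2 - p.1‖ := norm_pos_iff.2 (sub_ne_zero.2 (Ne.symm h))
  rw [fracGrad, dir, smul_smul, gagliardoQuotient_apply, kappa, norm_sub_rev p.1,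
    Real.rpow_add hn _ 1, Real.rpow_one]
  congr 1
  field_simp

lemma gagliardoQuotient_mul_inner_dir (u : E n → ℝ) (p : E n × E n) :
    gagliardoQuotient s u p * ⟪dir p, dir p⟫_ℝ = gagliardoQuotient s u p := by
  by_cases h : p.1 = p.2
  · simp [gagliardoQuotient_apply, h]
  have hn : 0 < ‖p.2 - p.1‖ := norm_pos_iff.2 (sub_ne_zero.2 (Ne.symm h))
  rw [real_inner_self_eq_norm_sq, dir, norm_smul, norm_inv, norm_norm, inv_mul_cancel₀ hn.ne']
  ring

lemma fracConst_pos (hs0 : 0 < s) (hs1 : s < 1) : 0 < fracConst n s := by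
  have h1 : 0 < Real.Gamma ((n : ℝ) / 2 + s) := Real.Gamma_pos_of_pos (by positivity)
  have h2 : Real.Gamma (-s) ≠ 0 := by
    refine Real.Gamma_ne_zero fun m hm => ?_
    have hm' : s = m := by linarith
    rcases Nat.eq_zero_or_pos m with rfl | h
    · simp at hm'; linarith
    · have : (1 : ℝ) ≤ m := by exact_mod_cast h
      linarith
  have h3 := Real.pi_pos
  unfold fracConst
  positivity

/-- The component of the field `A` in the direction from `x` to `y`. -/
def dirComp (A : E n × E n → E n) (p : E n × E n) : ℝ := ⟪A p, dir p⟫_ℝ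

lemma dirComp_symmPart_swap (A : E n × E n → E n) (p : E n × E n) :
    dirComp (symmPart A) p.swap = - dirComp (symmPart A) p := by
  simp only [dirComp, dir_swap, inner_neg_right, symmPart, Prod.fst_swap, Prod.snd_swap]
  rw [add_comm]

lemma dirComp_antisymmPart_swap (A : E n × E n → E n) (p : E n × E n) :
    dirComp (antisymmPart A) p.swap = dirComp (antisymmPart A) p := by
  have h : antisymmPart A p.swap = - antisymmPart A p := by
    obtain ⟨x, y⟩ := p
    simp only [antisymmPart, symmPart, Prod.swap_prod_mk]
    module
  simp only [dirComp, dir_swap, h, inner_neg_neg]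

lemma dirComp_add (A : E n × E n → E n) (p : E n × E n) :
    dirComp A p = dirComp (symmPart A) p + dirComp (antisymmPart A) p := by
  simp only [dirComp, antisymmPart, inner_sub_left]; ring

lemma abs_dirComp_le (A : E n × E n → E n) (p : E n × E n) : |dirComp A p| ≤ ‖A p‖ :=
  (abs_real_inner_le_norm _ _).trans (mul_le_of_le_one_right (norm_nonneg _) (norm_dir_le p))

/-- The fractional gradient points along y - x, so projecting `B` onto that line does not change the
pairing; on the diagonal the gradient is zero. -/
lemma inner_parallelPart_fracGrad (B : E n × E n → E n) (ψ : E n → ℝ) (p : E n × E n) :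
    ⟪parallelPart B p, fracGrad s ψ p⟫_ℝ =
      √(fracConst n s / 2) * (dirComp B p * gagliardoQuotient s ψ p) := by
  by_cases h : p.1 = p.2
  · simp [fracGrad, gagliardoQuotient_apply, h]
  have hn : ‖p.1 - p.2‖ ≠ 0 := norm_ne_zero_iff.2 (sub_ne_zero.2 h)
  rw [fracGrad_eq, parallelPart, if_pos h, dirComp, dir, inner_smul_left, inner_smul_right,
    inner_smul_right, inner_smul_right, ← neg_sub p.1 p.2, inner_neg_right, inner_neg_right,
    real_inner_self_eq_norm_sq, norm_neg]
  simp only [conj_trivial]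
  field_simp

lemma dirComp_nonneg {A : E n × E n → E n}
    (h : ∀ x y : E n, 0 ≤ ⟪parallelPart A (x, y), y - x⟫_ℝ) (p : E n × E n) :
    0 ≤ dirComp A p := by
  by_cases hp : p.1 = p.2
  · simp [dirComp, dir, hp]
  have h1 := h p.1 p.2
  have hn : ‖p.1 - p.2‖ ≠ 0 := norm_ne_zero_iff.2 (sub_ne_zero.2 hp)
  rw [parallelPart, if_pos hp, inner_smul_left, ← neg_sub p.1 p.2, inner_neg_right,
    real_inner_self_eq_norm_sq] at h1
  simp only [conj_trivial] at h1
  rw [mul_neg, div_mul_cancel₀ _ (pow_ne_zero 2 hn)] at h1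
  rw [dirComp, dir, inner_smul_right, ← neg_sub p.1 p.2, inner_neg_right]
  exact mul_nonneg (by positivity) h1

lemma inner_magGrad (A : E n × E n → E n) (u φ : E n → ℝ) (p : E n × E n) :
    ⟪magGrad s A u p, magGrad s A φ p⟫_ℝ =
      (√(fracConst n s / 2)) ^ 2 * (gagliardoQuotient s u p * gagliardoQuotient s φ p)
      + √(fracConst n s / 2) * (dirComp A p * φ p.1 * gagliardoQuotient s u p)
      + √(fracConst n s / 2) * (dirComp A p * u p.1 * gagliardoQuotient s φ p)
      + ‖A p‖ ^ 2 * (u p.1 * φ p.1) := by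
  simp only [magGrad, fracGrad_eq, inner_add_left, inner_add_right, inner_smul_left,
    inner_smul_right, conj_trivial, dirComp, real_inner_self_eq_norm_sq (A p),
    real_inner_comm (A p) (dir p)]
  have := gagliardoQuotient_mul_inner_dir (s := s) u p
  linear_combination ((√(fracConst n s / 2)) ^ 2 * gagliardoQuotient s φ p) * this

lemma isBddCompact_of_abs_le {b f : E n × E n → ℝ} (hb : Measurable b) (hf : Continuous f)
    (hfc : HasCompactSupport f) (h : ∀ p, |b p| ≤ |f p|) : IsBddCompact b := by
  obtain ⟨M, hM⟩ := hfc.exists_bound_of_continuous hf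
  refine ⟨hb, M, Prod.fst '' tsupport f ∪ Prod.snd '' tsupport f,
    (hfc.isCompact.image continuous_fst).union (hfc.isCompact.image continuous_snd), fun p => ?_⟩
  by_cases hp : p ∈ tsupport f
  · have h1 : p.1 ∈ Prod.fst '' tsupport f ∪ Prod.snd '' tsupport f := Or.inl ⟨p, hp, rfl⟩
    have h2 : p.2 ∈ Prod.fst '' tsupport f ∪ Prod.snd '' tsupport f := Or.inr ⟨p, hp, rfl⟩
    rw [indicator_of_mem h1, indicator_of_mem h2]
    simpa using (h p).trans (hM p)
  · have hM0 : 0 ≤ M := (norm_nonneg _).trans (hM p)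
    have hb0 : |b p| ≤ 0 := by simpa [image_eq_zero_of_notMem_tsupport hp] using h p
    refine hb0.trans (mul_nonneg hM0 (mul_nonneg ?_ ?_)) <;>
    exact indicator_nonneg (fun _ _ => zero_le_one) _

/-- The part of `IsWeakSolution` that makes the magnetic energy against `H̃^s(U)` finite. -/
structure FiniteEnergy (s : ℝ) (U : Set (E n)) (u : E n → ℝ) : Prop where
  locL2 : LocL2 u
  energy : MemLp (gagliardoQuotient s u) 2 (volume.restrict (U ×ˢ univ))

/-- The quotient is odd under the swap, so integrability on U × ℝⁿ transfers to ℝⁿ × U. The quotient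
of a test function vanishing off `U` is supported in this union, so nothing is needed on the
complement. -/
lemma FiniteEnergy.memLp_indicator {U : Set (E n)} (hU : MeasurableSet U) {u : E n → ℝ}
    (hu : FiniteEnergy s U u) :
    MemLp ((U ×ˢ univ ∪ univ ×ˢ U).indicator (gagliardoQuotient s u)) 2 volume := by
  have hm : MeasurableSet (U ×ˢ (univ : Set (E n))) := hU.prod .univ
  have hm' : MeasurableSet ((univ : Set (E n)) ×ˢ U) := MeasurableSet.univ.prod hU
  have h1 := ((memLp_indicator_iff_restrict hm).2 hu.energy).norm
  refine (h1.add (memLp_swap h1)).mono ((aestronglyMeasurable_gagliardoQuotient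
    hu.locL2.meas).indicator (hm.union hm')) (ae_of_all _ fun p => ?_)
  rw [Pi.add_apply, Real.norm_of_nonneg (add_nonneg (norm_nonneg _) (norm_nonneg _))]
  by_cases hp1 : p.1 ∈ U <;> by_cases hp2 : p.2 ∈ U <;>
    simp [hp1, hp2, gagliardoQuotient_swap, indicator]

section Integrability

variable {U : Set (E n)} {u φ : E n → ℝ}

lemma FiniteEnergy.integrable_mul_gagliardo (hU : MeasurableSet U) (hu : FiniteEnergy s U u)
    (hφ : MemSobolev s φ) (hφ0 : ∀ x ∉ U, φ x = 0) :
    Integrable (fun p => gagliardoQuotient s u p * gagliardoQuotient s φ p) volume := by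
  refine ((hu.memLp_indicator hU).integrable_mul hφ.memLp_gagliardo).congr
    (ae_of_all _ fun p => ?_)
  by_cases hp1 : p.1 ∈ U <;> by_cases hp2 : p.2 ∈ U <;>
    simp [hp1, hp2, indicator, hφ0, gagliardoQuotient_apply]

lemma FiniteEnergy.integrable_mul_fst (hU : MeasurableSet U) (hu : FiniteEnergy s U u)
    (hφ : MemLp φ 2 volume) (hφ0 : ∀ x ∉ U, φ x = 0) {b : E n × E n → ℝ} (hb : IsBddCompact b) :
    Integrable (fun p => b p * φ p.1 * gagliardoQuotient s u p) volume := by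
  refine ((hb.memLp_mul_fst (.of_memLp hφ)).integrable_mul (hu.memLp_indicator hU)).congr
    (ae_of_all _ fun p => ?_)
  by_cases hp1 : p.1 ∈ U <;> simp [hp1, indicator, hφ0]

lemma FiniteEnergy.integrable_mul_snd (hU : MeasurableSet U) (hu : FiniteEnergy s U u)
    (hφ : MemLp φ 2 volume) (hφ0 : ∀ x ∉ U, φ x = 0) {b : E n × E n → ℝ} (hb : IsBddCompact b) :
    Integrable (fun p => b p * φ p.2 * gagliardoQuotient s u p) volume := by
  refine ((hb.memLp_mul_snd (.of_memLp hφ)).integrable_mul (hu.memLp_indicator hU)).congr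
    (ae_of_all _ fun p => ?_)
  by_cases hp1 : p.2 ∈ U <;> simp [hp1, indicator, hφ0]

lemma LocL2.integrable_mul_gagliardo (hu : LocL2 u) (hφ : MemSobolev s φ)
    {b : E n × E n → ℝ} (hb : IsBddCompact b) :
    Integrable (fun p => b p * u p.1 * gagliardoQuotient s φ p) volume :=
  (hb.memLp_mul_fst hu).integrable_mul hφ.memLp_gagliardo

end Integrability

/-! ### The energy identity -/

lemma continuous_symmPart {A : E n × E n → E n} (hA : Continuous A) :
    Continuous (symmPart A) := by
  unfold symmPart; fun_prop

lemma continuous_antisymmPart {A : E n × E n → E n} (hA : Continuous A) :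
    Continuous (antisymmPart A) :=
  hA.sub (continuous_symmPart hA)

lemma hasCompactSupport_symmPart {A : E n × E n → E n} (hA : HasCompactSupport A) :
    HasCompactSupport (symmPart A) := by
  have h : HasCompactSupport (fun p : E n × E n => A p.swap) :=
    hA.comp_homeomorph (Homeomorph.prodComm (E n) (E n))
  exact (hA.add h).smul_left (f := fun _ => (1 / 2 : ℝ))

lemma isBddCompact_dirComp {A : E n × E n → E n} (hA : Continuous A) (hAc : HasCompactSupport A) :
    IsBddCompact (dirComp A) :=
  isBddCompact_of_abs_le (by have := hA.measurable; unfold dirComp; fun_prop) hA.norm hAc.norm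
    fun p => (abs_dirComp_le A p).trans (le_abs_self _)

lemma isBddCompact_norm {A : E n × E n → E n} (hA : Continuous A) (hAc : HasCompactSupport A) :
    IsBddCompact (fun p => ‖A p‖) :=
  isBddCompact_of_abs_le hA.norm.measurable hA.norm hAc.norm fun _ => le_rfl

/-- The density of the leading part of the magnetic energy. -/
def energyDensity (s : ℝ) (A : E n × E n → E n) (u φ : E n → ℝ) (p : E n × E n) : ℝ :=
  ((√(fracConst n s / 2)) ^ 2 * kappa s p ^ 2
      + √(fracConst n s / 2) * (dirComp (antisymmPart A) p * kappa s p))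
    * ((u p.1 - u p.2) * (φ p.1 - φ p.2))

section

variable {A : E n × E n → E n} {U : Set (E n)} {u φ : E n → ℝ}

lemma energyDensity_eq (p : E n × E n) : energyDensity s A u φ p =
    (√(fracConst n s / 2)) ^ 2 * (gagliardoQuotient s u p * gagliardoQuotient s φ p)
    + √(fracConst n s / 2) * (dirComp (antisymmPart A) p * φ p.1 * gagliardoQuotient s u p
      - dirComp (antisymmPart A) p * φ p.2 * gagliardoQuotient s u p) := by
  simp only [energyDensity, gagliardoQuotient_apply]; ring

lemma integrable_energyDensity (hA : Continuous A) (hAc : HasCompactSupport A)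
    (hU : MeasurableSet U) (hu : FiniteEnergy s U u) (hφ : MemSobolev s φ)
    (hφ0 : ∀ x ∉ U, φ x = 0) : Integrable (energyDensity s A u φ) volume := by
  have hb := isBddCompact_dirComp (continuous_antisymmPart hA)
    (hAc.sub (hasCompactSupport_symmPart hAc))
  have h := ((hu.integrable_mul_gagliardo hU hφ hφ0).const_mul ((√(fracConst n s / 2)) ^ 2)).add
    (((hu.integrable_mul_fst hU hφ.memLp hφ0 hb).sub
      (hu.integrable_mul_snd hU hφ.memLp hφ0 hb)).const_mul (√(fracConst n s / 2)))
  exact h.congr (ae_of_all _ fun p => (energyDensity_eq p).symm)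

/-- The magnetic energy of `u` against `φ`, with the first order terms rearranged by exchanging
the two variables. -/
theorem magLaplacian_eq (hA : Continuous A) (hAc : HasCompactSupport A)
    (hU : MeasurableSet U) (hu : FiniteEnergy s U u) (hφ : MemSobolev s φ)
    (hφ0 : ∀ x ∉ U, φ x = 0) :
    magLaplacian s A u φ = (∫ p, energyDensity s A u φ p)
      + fracDiv s (parallelPart (symmPart A)) (u * φ)
      + ∫ x in U, (∫ y : E n, ‖A (x, y)‖ ^ 2) * (u x * φ x) := by
  set c := √(fracConst n s / 2) with hc
  have hb := isBddCompact_dirComp hA hAc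
  have hbs := isBddCompact_dirComp (continuous_symmPart hA) (hasCompactSupport_symmPart hAc)
  have hN := isBddCompact_norm hA hAc
  have iE := integrable_energyDensity hA hAc hU hu hφ hφ0
  have iT : Integrable (fun p : E n × E n =>
      c * (dirComp (symmPart A) p * gagliardoQuotient s (u * φ) p)) volume := by
    refine (((hu.locL2.integrable_mul_gagliardo hφ hbs).add
      (hu.integrable_mul_snd hU hφ.memLp hφ0 hbs)).const_mul c).congr (ae_of_all _ fun p => ?_)
    simp only [Pi.add_apply, gagliardoQuotient_mul]
    ring
  have iN : Integrable (fun p : E n × E n => ‖A p‖ ^ 2 * (u p.1 * φ p.1)) volume := by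
    refine ((hN.memLp_mul_fst hu.locL2).integrable_mul
      (hN.memLp_mul_fst (.of_memLp hφ.memLp))).congr (ae_of_all _ fun p => ?_)
    simp only [Pi.mul_apply]
    ring
  have iI : Integrable (fun p : E n × E n => ⟪magGrad s A u p, magGrad s A φ p⟫_ℝ) volume := by
    simp only [inner_magGrad]
    exact ((((hu.integrable_mul_gagliardo hU hφ hφ0).const_mul (c ^ 2)).add
      ((hu.integrable_mul_fst hU hφ.memLp hφ0 hb).const_mul c)).add
      ((hu.locL2.integrable_mul_gagliardo hφ hb).const_mul c)).add iN
  have hT : fracDiv s (parallelPart (symmPart A)) (u * φ) =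
      ∫ p : E n × E n, c * (dirComp (symmPart A) p * gagliardoQuotient s (u * φ) p) := by
    simp only [fracDiv, inner_parallelPart_fracGrad, hc]
  have hNi : ∫ x in U, (∫ y : E n, ‖A (x, y)‖ ^ 2) * (u x * φ x) =
      ∫ p : E n × E n, ‖A p‖ ^ 2 * (u p.1 * φ p.1) := by
    rw [setIntegral_eq_integral_of_forall_compl_eq_zero (fun x hx => by simp [hφ0 x hx])]
    have := integral_prod (μ := (volume : Measure (E n))) (ν := (volume : Measure (E n))) _ iN
    refine Eq.trans ?_ this.symm
    simp only [integral_mul_const]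
  have iET : Integrable (fun p : E n × E n => energyDensity s A u φ p +
      c * (dirComp (symmPart A) p * gagliardoQuotient s (u * φ) p)) volume := iE.add iT
  have iETN : Integrable (fun p : E n × E n => energyDensity s A u φ p +
      c * (dirComp (symmPart A) p * gagliardoQuotient s (u * φ) p) +
      ‖A p‖ ^ 2 * (u p.1 * φ p.1)) volume := iET.add iN
  rw [hT, hNi, magLaplacian, ← sub_eq_zero, ← integral_add iE iT,
    ← integral_add iET iN, ← integral_sub iI iETN]
  set J : E n × E n → ℝ := fun p => ⟪magGrad s A u p, magGrad s A φ p⟫_ℝ -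
    (energyDensity s A u φ p + c * (dirComp (symmPart A) p * gagliardoQuotient s (u * φ) p) +
      ‖A p‖ ^ 2 * (u p.1 * φ p.1)) with hJ
  change ∫ p, J p = 0
  -- Expanding, the difference is cκ times σ(u(x) - u(y))(φ(x) - φ(y)) + a(u(x)φ(x) - u(y)φ(y)),
  -- where σ and a are the directional components of A_s and A_a. Since σ is odd and a is even under
  -- the swap, both terms are odd.
  have hanti : ∀ p, J p.swap = - J p := by
    intro p
    simp only [hJ, inner_magGrad, energyDensity, ← hc, gagliardoQuotient_swap, kappa_swap,
      dirComp_antisymmPart_swap, dirComp_symmPart_swap, dirComp_add A, Prod.fst_swap,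
      Prod.snd_swap]
    simp only [gagliardoQuotient_apply, Pi.mul_apply]
    ring
  have h1 := integral_comp_swap J
  simp only [hanti, integral_neg] at h1
  linarith

end

/-! ### The zeroth order form -/

lemma enorm_integral_mul_le {X : Type*} [MeasurableSpace X] {μ : Measure X} {f g : X → ℝ}
    (hf : AEStronglyMeasurable f μ) (hg : AEStronglyMeasurable g μ) :
    ‖∫ x, f x * g x ∂μ‖ₑ ≤ eLpNorm f 2 μ * eLpNorm g 2 μ := by
  refine (enorm_integral_le_lintegral_enorm _).trans ?_
  rw [← eLpNorm_one_eq_lintegral_enorm]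
  have h : eLpNorm (f • g) 1 μ ≤ eLpNorm f 2 μ * eLpNorm g 2 μ :=
    eLpNorm_smul_le_mul_eLpNorm (p := 2) (q := 2) (r := 1) hg hf
  exact h

lemma IsBddCompact.exists_eLpNorm_mul_fst_le {b : E n × E n → ℝ} (hb : IsBddCompact b) :
    ∃ C : ENNReal, C ≠ ⊤ ∧ ∀ v : E n → ℝ, AEStronglyMeasurable v volume →
      eLpNorm (fun p : E n × E n => b p * v p.1) 2 volume ≤ C * eLpNorm v 2 volume := by
  obtain ⟨M, K, hK, h⟩ := hb.bound
  set k : E n → ℝ := K.indicator 1 with hk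
  have hkm : Measurable k := measurable_one.indicator hK.measurableSet
  have hkL : MemLp k 2 volume :=
    memLp_indicator_const 2 hK.measurableSet 1 (Or.inr hK.measure_lt_top.ne)
  refine ⟨ENNReal.ofReal |M| * eLpNorm k 2 volume,
    ENNReal.mul_ne_top ENNReal.ofReal_ne_top hkL.2.ne, fun v hv => ?_⟩
  have hprod : eLpNorm (fun p : E n × E n => v p.1 * k p.2) 2 volume =
      eLpNorm v 2 volume * eLpNorm k 2 volume := by
    have hinj : ∀ a b : ENNReal, a ^ 2 = b ^ 2 → a = b := fun a b hab =>
      le_antisymm ((ENNReal.pow_le_pow_left_iff two_ne_zero).1 hab.le)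
        ((ENNReal.pow_le_pow_left_iff two_ne_zero).1 hab.ge)
    refine hinj _ _ ?_
    rw [mul_pow, eLpNorm_two_sq, eLpNorm_two_sq, eLpNorm_two_sq]
    simp only [enorm_mul, mul_pow]
    exact lintegral_prod_mul (hv.enorm.pow_const 2) (hkm.enorm.pow_const 2).aemeasurable
  rw [mul_assoc, mul_comm (eLpNorm k 2 volume), ← hprod]
  refine eLpNorm_le_mul_eLpNorm_of_ae_le_mul (ae_of_all _ fun p => ?_) 2
  have hk0 : ∀ x, 0 ≤ k x := fun x => indicator_nonneg (fun _ _ => zero_le_one) _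
  have hk1 : ∀ x, k x ≤ 1 := fun x => indicator_le_self' (fun _ _ => zero_le_one) x
  simp only [norm_mul, Real.norm_eq_abs]
  calc |b p| * |v p.1| ≤ (M * (k p.1 * k p.2)) * |v p.1| := by gcongr; exact h p
    _ ≤ (|M| * (1 * k p.2)) * |v p.1| := by
      gcongr
      · exact mul_nonneg (hk0 _) (hk0 _)
      · exact le_abs_self M
      · exact hk0 _
      · exact hk1 _
    _ = |M| * (|v p.1| * |k p.2|) := by rw [abs_of_nonneg (hk0 p.2)]; ring

lemma IsBddCompact.exists_eLpNorm_mul_snd_le {b : E n × E n → ℝ} (hb : IsBddCompact b) :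
    ∃ C : ENNReal, C ≠ ⊤ ∧ ∀ v : E n → ℝ, AEStronglyMeasurable v volume →
      eLpNorm (fun p : E n × E n => b p * v p.2) 2 volume ≤ C * eLpNorm v 2 volume := by
  obtain ⟨C, hC, h⟩ := hb.comp_swap.exists_eLpNorm_mul_fst_le
  refine ⟨C, hC, fun v hv => ?_⟩
  refine le_of_eq_of_le ?_ (h v hv)
  refine (eLpNorm_comp_measurePreserving (f := Prod.swap)
    (g := fun p : E n × E n => b p * v p.2) ?_ Measure.measurePreserving_swap).symm
  exact hb.measurable.aestronglyMeasurable.mul hv.comp_snd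

/-- The form whose nonnegativity is required in `PotentialCondition`. -/
def potentialForm (s : ℝ) (U : Set (E n)) (A : E n × E n → E n) (q : E n → ℝ) (ψ : E n → ℝ) : ℝ :=
  fracDiv s (parallelPart (symmPart A)) ψ
    + ∫ x in U, ((∫ y : E n, ‖A (x, y)‖ ^ 2) + q x) * ψ x

section

variable {A : E n × E n → E n} {U : Set (E n)} {q : E n → ℝ}

/-- The square of |A| is at most M² on a fixed compact set in y and zero off it, so its integral
over y is bounded uniformly in x. -/
lemma memLp_top_potential (hA : Continuous A) (hAc : HasCompactSupport A)
    (hq : MemLp q ⊤ (volume.restrict U)) :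
    MemLp (fun x => (∫ y : E n, ‖A (x, y)‖ ^ 2) + q x) ⊤ (volume.restrict U) := by
  refine MemLp.add ?_ hq
  obtain ⟨M, K, hK, h⟩ := (isBddCompact_norm hA hAc).bound
  have hm : StronglyMeasurable (fun x : E n => ∫ y : E n, ‖A (x, y)‖ ^ 2) :=
    StronglyMeasurable.integral_prod_right' (f := fun p : E n × E n => ‖A p‖ ^ 2)
      (hA.norm.pow 2).stronglyMeasurable
  refine memLp_top_of_bound hm.aestronglyMeasurable (M ^ 2 * volume.real K) (ae_of_all _ fun x => ?_)
  have hsq : ∀ y, ‖A (x, y)‖ ^ 2 ≤ K.indicator (fun _ => M ^ 2) y := by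
    intro y
    have h1 := h (x, y)
    rw [abs_norm] at h1
    by_cases hy : y ∈ K
    · by_cases hx : x ∈ K
      · simp only [hx, hy, indicator_of_mem, Pi.one_apply, mul_one] at h1 ⊢
        gcongr
      · simp only [hx, not_false_eq_true, indicator_of_notMem, zero_mul, mul_zero] at h1
        have : ‖A (x, y)‖ = 0 := le_antisymm h1 (norm_nonneg _)
        simp [hy, this, sq_nonneg]
    · simp only [hy, not_false_eq_true, indicator_of_notMem, mul_zero] at h1 ⊢
      have : ‖A (x, y)‖ = 0 := le_antisymm h1 (norm_nonneg _)
      simp [this]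
  rw [Real.norm_of_nonneg (integral_nonneg fun y => sq_nonneg _)]
  have hint : Integrable (K.indicator (fun _ : E n => M ^ 2)) volume :=
    (integrable_indicator_iff hK.measurableSet).2 (integrableOn_const hK.measure_lt_top.ne)
  refine (integral_mono_of_nonneg (ae_of_all _ fun y => sq_nonneg _) hint
    (ae_of_all _ hsq)).trans (le_of_eq ?_)
  rw [integral_indicator hK.measurableSet, setIntegral_const, smul_eq_mul, mul_comm]

lemma integrable_dirComp_mul_gagliardo_mul (hA : Continuous A) (hAc : HasCompactSupport A)
    {v z : E n → ℝ} (hv : MemSobolev s v) (hz : MemSobolev s z) :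
    Integrable (fun p => dirComp A p * gagliardoQuotient s (v * z) p) volume := by
  have hb := isBddCompact_dirComp hA hAc
  refine (((hb.memLp_mul_fst (.of_memLp hv.memLp)).integrable_mul hz.memLp_gagliardo).add
    ((hb.memLp_mul_snd (.of_memLp hz.memLp)).integrable_mul hv.memLp_gagliardo)).congr
    (ae_of_all _ fun p => ?_)
  simp only [Pi.add_apply, Pi.mul_apply, gagliardoQuotient_mul]
  ring

lemma integrable_potential_mul (hA : Continuous A) (hAc : HasCompactSupport A)
    (hq : MemLp q ⊤ (volume.restrict U)) {v z : E n → ℝ} (hv : MemLp v 2 volume)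
    (hz : MemLp z 2 volume) :
    Integrable (fun x => ((∫ y : E n, ‖A (x, y)‖ ^ 2) + q x) * (v * z) x)
      (volume.restrict U) := by
  have h := (memLp_top_potential hA hAc hq)
  have h1 := MemLp.smul (r := 1) ((hz.restrict U).smul (r := 1) (hv.restrict U)) h
  exact memLp_one_iff_integrable.1 h1

/-- Additivity is stated for products of H^s functions because that is where both integrands are
known to be integrable. -/
lemma potentialForm_mul_add_mul (hA : Continuous A) (hAc : HasCompactSupport A)
    (hq : MemLp q ⊤ (volume.restrict U)) {v z v' z' : E n → ℝ} (hv : MemSobolev s v)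
    (hz : MemSobolev s z) (hv' : MemSobolev s v') (hz' : MemSobolev s z') :
    potentialForm s U A q (v * z + v' * z') =
      potentialForm s U A q (v * z) + potentialForm s U A q (v' * z') := by
  have hs := continuous_symmPart hA
  have hsc := hasCompactSupport_symmPart hAc
  have h1 := integral_add ((integrable_dirComp_mul_gagliardo_mul hs hsc hv hz).const_mul
      (√(fracConst n s / 2)))
    ((integrable_dirComp_mul_gagliardo_mul hs hsc hv' hz').const_mul (√(fracConst n s / 2)))
  have h2 := integral_add (integrable_potential_mul hA hAc hq hv.memLp hz.memLp)
    (integrable_potential_mul hA hAc hq hv'.memLp hz'.memLp)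
  simp only [potentialForm, fracDiv, inner_parallelPart_fracGrad]
  rw [add_add_add_comm, ← h1, ← h2]
  congr 2
  · ext p
    rw [gagliardoQuotient_add, Pi.add_apply]; ring
  · ext x
    simp only [Pi.add_apply]; ring

/-- The divergence term is bounded by the Leibniz rule and Cauchy–Schwarz, with the bounded,
compactly supported field absorbing the undifferentiated factor. This continuity is what lets
nonnegativity pass from test functions to their closure. -/
lemma exists_enorm_potentialForm_mul_le (s : ℝ) (hA : Continuous A) (hAc : HasCompactSupport A)
    (hq : MemLp q ⊤ (volume.restrict U)) : ∃ C : ENNReal, C ≠ ⊤ ∧ ∀ v z : E n → ℝ,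
      MemSobolev s v → MemSobolev s z →
      ‖potentialForm s U A q (v * z)‖ₑ ≤ C * (sobolevNorm s v * sobolevNorm s z) := by
  have hs := continuous_symmPart hA
  have hsc := hasCompactSupport_symmPart hAc
  have hb := isBddCompact_dirComp hs hsc
  have hV := memLp_top_potential hA hAc hq
  obtain ⟨C₁, hC₁, h₁⟩ := hb.exists_eLpNorm_mul_fst_le
  obtain ⟨C₂, hC₂, h₂⟩ := hb.exists_eLpNorm_mul_snd_le
  set c := √(fracConst n s / 2) with hc
  set V : E n → ℝ := fun x => (∫ y : E n, ‖A (x, y)‖ ^ 2) + q x with hVdef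
  set C₃ := eLpNorm V ⊤ (volume.restrict U) with hC₃
  refine ⟨‖c‖ₑ * (C₁ + C₂) + C₃, ?_, fun v z hv hz => ?_⟩
  · exact ENNReal.add_ne_top.2 ⟨ENNReal.mul_ne_top enorm_ne_top (ENNReal.add_ne_top.2 ⟨hC₁, hC₂⟩),
      hV.2.ne⟩
  have nv : eLpNorm v 2 volume ≤ sobolevNorm s v := le_self_add
  have nz : eLpNorm z 2 volume ≤ sobolevNorm s z := le_self_add
  have gv : eLpNorm (gagliardoQuotient s v) 2 volume ≤ sobolevNorm s v := le_add_self
  have gz : eLpNorm (gagliardoQuotient s z) 2 volume ≤ sobolevNorm s z := le_add_self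
  have hdiv : fracDiv s (parallelPart (symmPart A)) (v * z) =
      c * ((∫ p, (dirComp (symmPart A) p * v p.1) * gagliardoQuotient s z p) +
        ∫ p, (dirComp (symmPart A) p * z p.2) * gagliardoQuotient s v p) := by
    have i1 := (hb.memLp_mul_fst (.of_memLp hv.memLp)).integrable_mul hz.memLp_gagliardo
    have i2 := (hb.memLp_mul_snd (.of_memLp hz.memLp)).integrable_mul hv.memLp_gagliardo
    have := integral_add i1 i2
    simp only [Pi.mul_apply] at this
    rw [← this, ← integral_const_mul]
    simp only [fracDiv, inner_parallelPart_fracGrad, gagliardoQuotient_mul, ← hc]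
    congr 1
    ext p
    ring
  have e1 : ‖∫ p, (dirComp (symmPart A) p * v p.1) * gagliardoQuotient s z p‖ₑ ≤
      C₁ * (sobolevNorm s v * sobolevNorm s z) := by
    refine (enorm_integral_mul_le (hb.memLp_mul_fst (.of_memLp hv.memLp)).1
      hz.memLp_gagliardo.1).trans ?_
    rw [← mul_assoc]
    exact mul_le_mul' ((h₁ v hv.1).trans (by gcongr)) gz
  have e2 : ‖∫ p, (dirComp (symmPart A) p * z p.2) * gagliardoQuotient s v p‖ₑ ≤
      C₂ * (sobolevNorm s v * sobolevNorm s z) := by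
    refine (enorm_integral_mul_le (hb.memLp_mul_snd (.of_memLp hz.memLp)).1
      hv.memLp_gagliardo.1).trans ?_
    rw [mul_comm (sobolevNorm s v), ← mul_assoc]
    exact mul_le_mul' ((h₂ z hz.1).trans (by gcongr)) gv
  have e3 : ‖∫ x in U, V x * (v * z) x‖ₑ ≤ C₃ * (sobolevNorm s v * sobolevNorm s z) := by
    simp only [Pi.mul_apply, ← mul_assoc]
    refine (enorm_integral_mul_le (hV.1.mul (hv.1.restrict)) hz.1.restrict).trans ?_
    refine mul_le_mul' ?_ ((eLpNorm_mono_measure z Measure.restrict_le_self).trans nz)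
    refine (eLpNorm_smul_le_mul_eLpNorm (p := ⊤) (q := 2) (r := 2) hv.1.restrict hV.1).trans ?_
    exact mul_le_mul' le_rfl ((eLpNorm_mono_measure v Measure.restrict_le_self).trans nv)
  rw [potentialForm, hdiv]
  refine (enorm_add_le _ _).trans ?_
  rw [add_mul]
  refine add_le_add ?_ e3
  rw [enorm_mul, mul_assoc, add_mul]
  gcongr
  exact (enorm_add_le _ _).trans (add_le_add e1 e2)

/-- The form in `PotentialCondition` is nonnegative on squares of functions in `H̃^s`. -/
theorem PotentialCondition.potentialForm_mul_self_nonneg (hA : Continuous A)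
    (hAc : HasCompactSupport A) (hq : MemLp q ⊤ (volume.restrict U))
    (h : PotentialCondition s U A q) {w : E n → ℝ} (hw : MemSobolevTilde s U w) :
    0 ≤ potentialForm s U A q (w * w) := by
  obtain ⟨C, hC, hb⟩ := exists_enorm_potentialForm_mul_le s hA hAc hq
  by_contra! hneg
  set N := sobolevNorm s w with hN
  have hNtop : N ≠ ⊤ := hw.1.2.ne
  have hpos : 0 < ‖potentialForm s U A q (w * w)‖ₑ := by simpa using hneg.ne
  have hlim : Filter.Tendsto (fun ε : ENNReal => C * (ε * (N + N + ε))) (nhds 0) (nhds 0) := by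
    have h1 : Filter.Tendsto (fun ε : ENNReal => N + N + ε) (nhds 0) (nhds (N + N + 0)) :=
      tendsto_const_nhds.add Filter.tendsto_id
    have h2 := ENNReal.Tendsto.mul (Filter.tendsto_id (x := nhds (0 : ENNReal)))
      (Or.inr (by simp [hNtop])) h1 (Or.inr ENNReal.zero_ne_top)
    have h3 := ENNReal.Tendsto.const_mul (a := C) h2 (Or.inr hC)
    simpa using h3
  obtain ⟨ε, hε0, hε⟩ : ∃ ε : ENNReal, 0 < ε ∧
      C * (ε * (N + N + ε)) < ‖potentialForm s U A q (w * w)‖ₑ := by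
    have h1 := (hlim.eventually (Iio_mem_nhds hpos)).filter_mono
      (nhdsWithin_le_nhds (s := Ioi (0 : ENNReal)))
    obtain ⟨ε, h2, h3⟩ := (h1.and self_mem_nhdsWithin).exists
    exact ⟨ε, h3, h2⟩
  obtain ⟨ψ, hψ, hψε⟩ := hw.2 ε hε0
  have hψm : AEStronglyMeasurable ψ volume := hψ.1.continuous.aestronglyMeasurable
  have hd : MemSobolev s (w - ψ) := ⟨hw.1.1.sub hψm, hψε.trans_le le_top⟩
  have hψS : MemSobolev s ψ := by simpa using hw.1.sub hd
  have hsum : MemSobolev s (w + ψ) := hw.1.add hψS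
  have hψ2 : 0 ≤ potentialForm s U A q (ψ * ψ) := by
    refine h (ψ * ψ) ⟨hψ.1.mul hψ.1, hψ.2.1.mul_left, ?_⟩ fun x => mul_self_nonneg (ψ x)
    exact (tsupport_mul_subset_left).trans hψ.2.2
  -- The factorization w² = (w - ψ)(w + ψ) + ψ² has a small first term, by boundedness of the form,
  -- and a nonnegative second term.
  have hdec : potentialForm s U A q (w * w) =
      potentialForm s U A q ((w - ψ) * (w + ψ)) + potentialForm s U A q (ψ * ψ) := by
    rw [← potentialForm_mul_add_mul hA hAc hq hd hsum hψS hψS]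
    congr 1
    ring
  have hle : ‖potentialForm s U A q (w * w)‖ₑ ≤
      ‖potentialForm s U A q ((w - ψ) * (w + ψ))‖ₑ := by
    rw [← ofReal_norm, ← ofReal_norm, Real.norm_eq_abs, Real.norm_eq_abs]
    refine ENNReal.ofReal_le_ofReal ?_
    rw [abs_of_neg hneg, abs_of_nonpos (by linarith)]
    linarith
  have hNsum : sobolevNorm s (w + ψ) ≤ N + N + ε := by
    have e : w + ψ = w + w + (ψ - w) := by abel
    have e' : sobolevNorm s (ψ - w) = sobolevNorm s (w - ψ) := by
      rw [← neg_sub w ψ]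
      have hG : gagliardoQuotient s (-(w - ψ)) = - gagliardoQuotient s (w - ψ) := by
        ext p; simp only [gagliardoQuotient_apply, Pi.neg_apply]; ring
      rw [sobolevNorm, sobolevNorm, hG, eLpNorm_neg, eLpNorm_neg]
    rw [e]
    refine (sobolevNorm_add_le (hw.1.1.add hw.1.1) (hψm.sub hw.1.1)).trans ?_
    refine add_le_add (sobolevNorm_add_le hw.1.1 hw.1.1) ?_
    rw [e']
    exact hψε.le
  have := (hle.trans (hb _ _ hd hsum)).trans (b := C * (sobolevNorm s (w - ψ) *
    sobolevNorm s (w + ψ))) (c := C * (ε * (N + N + ε))) (by gcongr)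
  exact absurd hε this.not_gt

end

/-! ### Weak solutions -/

section

variable {A : E n × E n → E n} {U : Set (E n)} {q F g u u' : E n → ℝ}

lemma IsWeakSolution.congr_ae (hu : IsWeakSolution s U A q F g u) (h : u =ᵐ[volume] u') :
    IsWeakSolution s U A q F g u' := by
  have hr : ∀ S : Set (E n), u =ᵐ[volume.restrict S] u' := fun S => ae_restrict_of_ae h
  have hfst : ∀ᵐ p : E n × E n, u p.1 = u' p.1 := Measure.quasiMeasurePreserving_fst.ae h
  have hG : fracGrad s u =ᵐ[volume] fracGrad s u' := by
    filter_upwards [gagliardoQuotient_congr_ae (s := s) h] with p hp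
    rw [fracGrad_eq, fracGrad_eq, hp]
  obtain ⟨v, hv, huv⟩ := hu.memSobolevOn
  refine ⟨⟨v, hv, (hr U).symm.trans huv⟩, hu.energy.ae_eq (ae_restrict_of_ae hG),
    (hr _).symm.trans hu.exterior, fun φ hφ => ?_⟩
  have h1 : magLaplacian s A u' φ = magLaplacian s A u φ := by
    refine integral_congr_ae ?_
    filter_upwards [hG, hfst] with p hp hp'
    simp only [magGrad, hp, hp']
  have h2 : ∫ x in U, q x * u' x * φ x = ∫ x in U, q x * u x * φ x := by
    refine integral_congr_ae ?_
    filter_upwards [hr U] with x hx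
    rw [hx]
  rw [h1, h2]
  exact hu.weak φ hφ

lemma IsLipschitzDomain.ae_mem_union (hU : IsLipschitzDomain U) :
    ∀ᵐ x : E n, x ∈ U ∪ (closure U)ᶜ := by
  have h : ∀ᵐ x : E n, x ∉ frontier U := measure_eq_zero_iff_ae_notMem.1 hU.volume_frontier
  filter_upwards [h] with x hx
  rw [hU.1.frontier_eq] at hx
  by_contra! hc
  simp only [mem_union, mem_compl_iff, not_or, not_not] at hc
  exact hx ⟨hc.2, hc.1⟩

lemma IsWeakSolution.memLp_indicator (hU : IsOpen U) (hu : IsWeakSolution s U A q F g u) :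
    MemLp (U.indicator u) 2 volume := by
  obtain ⟨v, hv, huv⟩ := hu.memSobolevOn
  exact (memLp_indicator_iff_restrict hU.measurableSet).2 ((hv.memLp.restrict U).ae_eq huv.symm)

lemma abs_gagliardoQuotient_le (hs0 : 0 < s) (hs1 : s < 1) (u : E n → ℝ) (p : E n × E n) :
    |gagliardoQuotient s u p| ≤ (√(fracConst n s / 2))⁻¹ * ‖fracGrad s u p‖ := by
  have hc : 0 < √(fracConst n s / 2) := Real.sqrt_pos.2 (half_pos (fracConst_pos hs0 hs1))
  have h := gagliardoQuotient_mul_inner_dir (s := s) u p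
  rw [fracGrad_eq, norm_smul, norm_mul, Real.norm_of_nonneg hc.le, Real.norm_eq_abs,
    ← mul_assoc, ← mul_assoc, inv_mul_cancel₀ hc.ne', one_mul]
  calc |gagliardoQuotient s u p| = |gagliardoQuotient s u p| * ‖dir p‖ * ‖dir p‖ := by
        conv_lhs => rw [← h, real_inner_self_eq_norm_sq, abs_mul, abs_of_nonneg (sq_nonneg ‖dir p‖)]
        ring
    _ ≤ |gagliardoQuotient s u p| * ‖dir p‖ :=
        mul_le_of_le_one_right (by positivity) (norm_dir_le p)

/-- Inside, `u` is square integrable; outside it equals the bounded `g`, hence is locally square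
integrable. The null boundary lets the two pieces be glued. -/
lemma IsWeakSolution.finiteEnergy (hs0 : 0 < s) (hs1 : s < 1) (hU : IsLipschitzDomain U)
    (hg : MemLp g ⊤ (volume.restrict (closure U)ᶜ)) (hu : IsWeakSolution s U A q F g u) :
    FiniteEnergy s U u := by
  have hext : MeasurableSet (closure U)ᶜ := isClosed_closure.measurableSet.compl
  have hug : MemLp u ⊤ (volume.restrict (closure U)ᶜ) := hg.ae_eq hu.exterior.symm
  have hd : U.indicator u + (closure U)ᶜ.indicator u =ᵐ[volume] u := by
    filter_upwards [hU.ae_mem_union] with x hx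
    by_cases hxU : x ∈ U
    · have : x ∉ (closure U)ᶜ := fun h => h (subset_closure hxU)
      simp [hxU, this]
    · have : x ∈ (closure U)ᶜ := hx.resolve_left hxU
      simp [hxU, this]
  have h1 := hu.memLp_indicator hU.1
  have hm : AEStronglyMeasurable u volume :=
    (h1.1.add ((aestronglyMeasurable_indicator_iff hext).2 hug.1)).congr hd
  refine ⟨⟨hm, fun K hK => ?_⟩, ?_⟩
  · refine ((h1.restrict K).add ?_).ae_eq (ae_restrict_of_ae hd)
    rw [memLp_indicator_iff_restrict hext, Measure.restrict_comm hext]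
    have : IsFiniteMeasure ((volume.restrict (closure U)ᶜ).restrict K) :=
      ⟨by rw [Measure.restrict_apply_univ]
          exact (Measure.restrict_le_self K).trans_lt hK.measure_lt_top⟩
    exact (hug.restrict K).mono_exponent le_top
  · exact hu.energy.of_le_mul (c := (√(fracConst n s / 2))⁻¹)
      (aestronglyMeasurable_gagliardoQuotient hm).restrict
      (ae_of_all _ (abs_gagliardoQuotient_le hs0 hs1 u))

/-- The weak formulation, with the first order terms absorbed in the zeroth order form. -/
lemma IsWeakSolution.energy_eq (hs0 : 0 < s) (hs1 : s < 1) (hU : IsLipschitzDomain U)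
    (hUb : Bornology.IsBounded U) (hA : Continuous A) (hAc : HasCompactSupport A)
    (hq : MemLp q ⊤ (volume.restrict U)) (hu : IsWeakSolution s U A q F g u)
    (hE : FiniteEnergy s U u) {φ : E n → ℝ} (hφ : MemSobolev s φ) (hφ0 : ∀ x ∉ U, φ x = 0) :
    (∫ p, energyDensity s A u φ p) + potentialForm s U A q (u * φ) = ∫ x in U, F x * φ x := by
  have hUm := hU.1.measurableSet
  have hweak := hu.weak φ (hU.memSobolevTilde hs0 hs1 hUb hφ hφ0)
  rw [magLaplacian_eq hA hAc hUm hE hφ hφ0] at hweak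
  have h1 := hu.memLp_indicator hU.1
  -- Since `u` need not be globally square integrable, it is cut off to `U`, which does not affect
  -- integrals over `U`.
  have i1 := integrable_potential_mul hA hAc hq h1 hφ.memLp
  have i2 := integrable_potential_mul (q := 0) hA hAc MemLp.zero h1 hφ.memLp
    (U := U)
  have e1 : ∫ x in U, ((∫ y : E n, ‖A (x, y)‖ ^ 2) + q x) * (u * φ) x =
      (∫ x in U, (∫ y : E n, ‖A (x, y)‖ ^ 2) * (u x * φ x)) + ∫ x in U, q x * u x * φ x := by
    rw [← sub_eq_iff_eq_add']
    have h := integral_sub i1 i2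
    have c1 : ∀ {f g : E n → ℝ}, (∀ x ∈ U, f x = g x) → ∫ x in U, f x = ∫ x in U, g x :=
      fun h => setIntegral_congr_fun hUm h
    refine Eq.trans ?_ (h.symm.trans ?_)
    · congr 1 <;> refine c1 fun x hx => ?_ <;> simp [hx]
    · refine c1 fun x hx => ?_
      simp [hx]; ring
  rw [potentialForm, e1]
  linarith

lemma potentialForm_neg (ψ : E n → ℝ) :
    potentialForm s U A q (-ψ) = - potentialForm s U A q ψ := by
  have h : ∀ p, gagliardoQuotient s (-ψ) p = - gagliardoQuotient s ψ p := fun p => by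
    simp only [gagliardoQuotient_apply, Pi.neg_apply]; ring
  simp only [potentialForm, fracDiv, inner_parallelPart_fracGrad, h, Pi.neg_apply, mul_neg,
    integral_neg]
  ring

/-! ### The weak maximum principle -/

/-- Taking the negative part is 1-Lipschitz, and the result vanishes off `U`; its quotient is thus
dominated by that of `u` on the pairs meeting `U` and is zero elsewhere. -/
lemma FiniteEnergy.memSobolev_negPart (hU : MeasurableSet U) (hE : FiniteEnergy s U u)
    (hu2 : MemLp (U.indicator u) 2 volume) (h0 : ∀ x ∉ U, 0 ≤ u x) :
    MemSobolev s (fun x => max (-u x) 0) := by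
  have hm : AEStronglyMeasurable (fun x => max (-u x) 0) volume :=
    hE.locL2.meas.neg.sup aestronglyMeasurable_const
  refine memSobolev_iff.2 ⟨hu2.mono hm (ae_of_all _ fun x => ?_),
    (hE.memLp_indicator hU).mono (aestronglyMeasurable_gagliardoQuotient hm)
      (ae_of_all _ fun p => ?_)⟩
  · by_cases hx : x ∈ U
    · rw [indicator_of_mem hx, Real.norm_of_nonneg (le_max_right _ _)]
      exact max_le (neg_le_abs _) (abs_nonneg _)
    · simp [hx, h0 x hx]
  · have hlip : |max (-u p.1) 0 - max (-u p.2) 0| ≤ |u p.1 - u p.2| := by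
      refine (abs_max_sub_max_le_abs _ _ _).trans (le_of_eq ?_)
      rw [← abs_neg]; congr 1; ring
    by_cases hp : p ∈ U ×ˢ univ ∪ univ ×ˢ U
    · rw [indicator_of_mem hp, gagliardoQuotient_apply, gagliardoQuotient_apply, norm_mul, norm_mul]
      exact mul_le_mul_of_nonneg_left hlip (norm_nonneg _)
    · simp only [mem_union, mem_prod, mem_univ, and_true, true_and, not_or] at hp
      simp [gagliardoQuotient_apply, h0 _ hp.1, h0 _ hp.2]

/-- Testing with the negative part forces its seminorm to be zero. An exterior of positive measure
then supplies a point at which the resulting constant is zero. -/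
lemma IsWeakSolution.nonneg (hs0 : 0 < s) (hs1 : s < 1) (hU : IsLipschitzDomain U)
    (hUb : Bornology.IsBounded U) (hA : Continuous A) (hAc : HasCompactSupport A)
    (hAa : ∀ p, 0 ≤ dirComp (antisymmPart A) p) (hq : MemLp q ⊤ (volume.restrict U))
    (hAq : PotentialCondition s U A q) (hF0 : ∀ᵐ x ∂(volume.restrict U), 0 ≤ F x)
    (hg : MemLp g ⊤ (volume.restrict (closure U)ᶜ))
    (hg0 : ∀ᵐ x ∂(volume.restrict (closure U)ᶜ), 0 ≤ g x)
    (hext : volume (closure U)ᶜ ≠ 0) (hu : IsWeakSolution s U A q F g u) :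
    ∀ᵐ x : E n, 0 ≤ u x := by
  have hUm := hU.1.measurableSet
  -- Replacing `u` by |u| off `U` changes it only on a null set, including possibly the boundary,
  -- and makes the negative part vanish at every point off `U`.
  wlog h0 : ∀ x ∉ U, 0 ≤ u x generalizing u
  · classical
    have he : u =ᵐ[volume] fun x => if x ∈ U then u x else |u x| := by
      have h1 := ae_imp_of_ae_restrict hu.exterior
      have h2 := ae_imp_of_ae_restrict hg0
      filter_upwards [h1, h2, hU.ae_mem_union] with x h1 h2 h3
      by_cases hx : x ∈ U
      · simp [hx]
      · have h4 := h3.resolve_left hx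
        rw [if_neg hx, abs_of_nonneg]
        rw [h1 h4]; exact h2 h4
    have := this (hu.congr_ae he) fun x hx => by simp [hx]
    filter_upwards [this, he] with x h1 h2
    rw [h2]; exact h1
  have hE := hu.finiteEnergy hs0 hs1 hU hg
  set φ : E n → ℝ := fun x => max (-u x) 0 with hφdef
  have hφ : MemSobolev s φ := hE.memSobolev_negPart hUm (hu.memLp_indicator hU.1) h0
  have hφ0 : ∀ x ∉ U, φ x = 0 := fun x hx => by simp [hφdef, h0 x hx]
  have hφn : ∀ x, 0 ≤ φ x := fun x => le_max_right _ _
  have hen := hu.energy_eq hs0 hs1 hU hUb hA hAc hq hE hφ hφ0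
  have huφ : u * φ = - (φ * φ) := by
    ext x
    simp only [Pi.mul_apply, Pi.neg_apply, hφdef]
    rcases le_total (-u x) 0 with h | h
    · simp [max_eq_right h]
    · simp [max_eq_left h]
  have hpot := hAq.potentialForm_mul_self_nonneg hA hAc hq (hU.memSobolevTilde hs0 hs1 hUb hφ hφ0)
  rw [huφ, potentialForm_neg] at hen
  have hFφ : 0 ≤ ∫ x in U, F x * φ x :=
    integral_nonneg_of_ae (by filter_upwards [hF0] with x hx using mul_nonneg hx (hφn x))
  set c := √(fracConst n s / 2) with hc
  have hcpos : 0 < c := Real.sqrt_pos.2 (half_pos (fracConst_pos hs0 hs1))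
  have hpt : ∀ p, (gagliardoQuotient s φ p) ^ 2 * c ^ 2 ≤ - energyDensity s A u φ p := by
    intro p
    -- Split u into positive part minus φ; the two parts have product zero at each point, so the
    -- cross terms are nonpositive.
    have h1 : (u p.1 - u p.2) * (φ p.1 - φ p.2) ≤ - (φ p.1 - φ p.2) ^ 2 := by
      have e : ∀ x, u x = max (u x) 0 - φ x := fun x => by
        rcases le_total (u x) 0 with h | h
        · simp [hφdef, h]
        · simp [hφdef, h]
      have z : ∀ x, max (u x) 0 * φ x = 0 := fun x => by
        rcases le_total (u x) 0 with h | h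
        · simp [h]
        · simp [hφdef, h]
      have a1 : 0 ≤ max (u p.1) 0 := le_max_right _ _
      have a2 : 0 ≤ max (u p.2) 0 := le_max_right _ _
      have b1 := mul_nonneg a1 (hφn p.2)
      have b2 := mul_nonneg a2 (hφn p.1)
      have z1 := z p.1
      have z2 := z p.2
      rw [e p.1, e p.2]
      nlinarith
    have h2 : 0 ≤ c * (dirComp (antisymmPart A) p * kappa s p) :=
      mul_nonneg hcpos.le (mul_nonneg (hAa p) (kappa_nonneg p))
    rw [energyDensity, gagliardoQuotient_apply, ← hc]
    nlinarith [mul_nonneg h2 (sq_nonneg (φ p.1 - φ p.2)),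
      mul_le_mul_of_nonneg_left h1 (add_nonneg (by positivity : 0 ≤ c ^ 2 * kappa s p ^ 2) h2)]
  have hint : Integrable (fun p => (gagliardoQuotient s φ p) ^ 2 * c ^ 2) volume :=
    hφ.memLp_gagliardo.integrable_sq.mul_const _
  have hle : ∫ p, (gagliardoQuotient s φ p) ^ 2 * c ^ 2 ≤ 0 := by
    refine (integral_mono hint (integrable_energyDensity hA hAc hUm hE hφ hφ0).neg hpt).trans ?_
    simp only [Pi.neg_apply, integral_neg]
    linarith
  have hzero := (integral_eq_zero_iff_of_nonneg (fun p => by positivity) hint).1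
    (le_antisymm hle (integral_nonneg fun p => by positivity))
  have hprod : ∀ᵐ x : E n, ∀ᵐ y : E n, gagliardoQuotient s φ (x, y) ^ 2 * c ^ 2 = 0 :=
    Measure.ae_ae_of_ae_prod hzero
  filter_upwards [hprod] with x hx
  by_contra! hneg
  have hxU : x ∈ U := by by_contra h; exact absurd (h0 x h) (not_le.2 hneg)
  obtain ⟨y, hy, hyx⟩ : ∃ y ∈ (closure U)ᶜ, gagliardoQuotient s φ (x, y) ^ 2 * c ^ 2 = 0 := by
    by_contra! hcon
    exact hext (measure_mono_null (fun y hy => hcon y hy) hx)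
  have hyU : y ∉ U := fun h => hy (subset_closure h)
  have hne : x ≠ y := fun h => hyU (h ▸ hxU)
  have hk := kappa_pos (s := s) (p := (x, y)) hne
  have hφx : φ x = 0 := by
    simpa [gagliardoQuotient_apply, hk.ne', hcpos.ne', hφ0 y hyU] using hyx
  have : -u x ≤ φ x := le_max_left _ _
  linarith

end

/-! ### The strong maximum principle -/

lemma abs_sqrt_div_sqrt_sub_le {ε a b : ℝ} (hε : 0 < ε) (ha : 0 ≤ a) (hb : 0 ≤ b) :
    |√ε / √(a + ε) - √ε / √(b + ε)| ≤ (2 * ε)⁻¹ * |a - b| := by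
  set e := √ε with he
  set α := √(a + ε) with hα
  set β := √(b + ε) with hβ
  have he0 : 0 < e := Real.sqrt_pos.2 hε
  have heα : e ≤ α := Real.sqrt_le_sqrt (by linarith)
  have heβ : e ≤ β := Real.sqrt_le_sqrt (by linarith)
  have hα0 : 0 < α := he0.trans_le heα
  have hβ0 : 0 < β := he0.trans_le heβ
  have hee : e ^ 2 = ε := Real.sq_sqrt hε.le
  have hab : a - b = (α - β) * (α + β) := by
    have h1 : α ^ 2 = a + ε := Real.sq_sqrt (by linarith)
    have h2 : β ^ 2 = b + ε := Real.sq_sqrt (by linarith)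
    linear_combination h2 - h1
  have hdiv : e / α - e / β = - (e / (α * β) * (α - β)) := by
    field_simp; ring
  have h3 : e / (α * β) ≤ (2 * ε)⁻¹ * (α + β) := by
    rw [← hee, div_le_iff₀ (by positivity)]
    have : e * (2 * e ^ 2) ≤ (α + β) * (α * β) := by
      calc e * (2 * e ^ 2) = (e + e) * (e * e) := by ring
        _ ≤ (α + β) * (α * β) := by gcongr
    calc e = (2 * e ^ 2)⁻¹ * (e * (2 * e ^ 2)) := by field_simp
      _ ≤ (2 * e ^ 2)⁻¹ * ((α + β) * (α * β)) := by gcongr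
      _ = _ := by ring
  rw [hdiv, abs_neg, abs_mul, abs_of_pos (by positivity : 0 < e / (α * β)), hab, abs_mul,
    abs_of_pos (by positivity : 0 < α + β), mul_comm |α - β|, ← mul_assoc]
  gcongr

lemma abs_inv_sub_inv_le {ε a b : ℝ} (hε : 0 < ε) (ha : 0 ≤ a) (hb : 0 ≤ b) :
    |(a + ε)⁻¹ - (b + ε)⁻¹| ≤ (ε * ε)⁻¹ * |a - b| := by
  have h1 : 0 < a + ε := by linarith
  have h2 : 0 < b + ε := by linarith
  have e : (a + ε)⁻¹ - (b + ε)⁻¹ = - (((a + ε) * (b + ε))⁻¹ * (a - b)) := by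
    field_simp; ring
  rw [e, abs_neg, abs_mul, abs_of_pos (by positivity : 0 < ((a + ε) * (b + ε))⁻¹)]
  gcongr <;> linarith

section

variable {A : E n × E n → E n} {U : Set (E n)} {q F g u η v : E n → ℝ}

lemma IsTestFunction.eq_zero (hη : IsTestFunction U η) {x : E n} (hx : x ∉ U) : η x = 0 :=
  image_eq_zero_of_notMem_tsupport fun h => hx (hη.2.2 h)

lemma IsTestFunction.mul (hη : IsTestFunction U η) : IsTestFunction U (η * η) :=
  ⟨hη.1.mul hη.1, hη.2.1.mul_left, (tsupport_mul_subset_left).trans hη.2.2⟩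

/-- Used for `v` a bounded Lipschitz function of `u`. In the Leibniz rule the quotient of `v`
appears only with the factor η(x), hence only where the energy of `u` is finite. -/
lemma FiniteEnergy.memSobolev_mul (hs0 : 0 < s) (hs1 : s < 1) (hU : MeasurableSet U)
    (hE : FiniteEnergy s U u) (hη : IsTestFunction U η) (hv : Measurable v) {M L : ℝ}
    (hM : ∀ x, |v x| ≤ M) (hL : ∀ x y, |v x - v y| ≤ L * |u x - u y|) : MemSobolev s (η * v) := by
  have hηS := hη.memSobolev hs0 hs1
  obtain ⟨C, hC⟩ := hη.2.1.exists_bound_of_continuous hη.1.continuous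
  have h1 : MemLp (fun p : E n × E n => η p.1 * gagliardoQuotient s v p) 2 volume := by
    refine (hE.memLp_indicator hU).of_le_mul (c := C * L) (hηS.1.comp_fst.mul
      (aestronglyMeasurable_gagliardoQuotient hv.aestronglyMeasurable)) (ae_of_all _ fun p => ?_)
    by_cases hp : p.1 ∈ U
    · have hC0 : 0 ≤ C := (norm_nonneg _).trans (hC p.1)
      have hp' : p ∈ U ×ˢ univ ∪ univ ×ˢ U := Or.inl ⟨hp, mem_univ _⟩
      rw [indicator_of_mem hp', gagliardoQuotient_apply, gagliardoQuotient_apply, norm_mul,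
        norm_mul, norm_mul]
      calc ‖η p.1‖ * (‖kappa s p‖ * ‖v p.1 - v p.2‖)
          ≤ C * (‖kappa s p‖ * (L * |u p.1 - u p.2|)) := by
            gcongr
            · exact hC _
            · exact hL _ _
        _ = _ := by rw [Real.norm_eq_abs (u p.1 - u p.2)]; ring
    · simp only [hη.eq_zero hp, zero_mul, norm_zero]
      by_cases hp2 : p.2 ∈ U
      · have hC0 : 0 ≤ C := (norm_nonneg _).trans (hC p.1)
        by_cases huu : u p.1 = u p.2
        · simp [gagliardoQuotient_apply, huu, indicator]
        · have hL0 : 0 ≤ L := by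
            by_contra! hneg
            have h3 := (abs_nonneg _).trans (hL p.1 p.2)
            have h4 : 0 < |u p.1 - u p.2| := abs_pos.2 (sub_ne_zero.2 huu)
            nlinarith
          positivity
      · simp [indicator, hp, hp2]
  have h2 : MemLp (fun p : E n × E n => v p.2 * gagliardoQuotient s η p) 2 volume :=
    hηS.memLp_gagliardo.of_le_mul (c := M)
      ((hv.comp measurable_snd).aestronglyMeasurable.mul hηS.memLp_gagliardo.1)
      (ae_of_all _ fun p => by
        rw [norm_mul]; exact mul_le_mul_of_nonneg_right (hM p.2) (norm_nonneg _))
  refine memSobolev_iff.2 ⟨hηS.memLp.of_le_mul (c := M) (hηS.1.mul hv.aestronglyMeasurable)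
    (ae_of_all _ fun x => ?_), ?_⟩
  · rw [Pi.mul_apply, norm_mul, mul_comm]
    exact mul_le_mul_of_nonneg_right (hM x) (norm_nonneg _)
  · exact (h1.add h2).ae_eq (ae_of_all _ fun p => (gagliardoQuotient_mul η v p).symm)

/-- Test the equation with `η² / (u + ε)`. -/
lemma IsWeakSolution.neg_integral_energyDensity_le (hs0 : 0 < s) (hs1 : s < 1)
    (hU : IsLipschitzDomain U) (hUb : Bornology.IsBounded U) (hA : Continuous A)
    (hAc : HasCompactSupport A) (hq : MemLp q ⊤ (volume.restrict U))
    (hAq : PotentialCondition s U A q) (hF0 : ∀ᵐ x ∂(volume.restrict U), 0 ≤ F x)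
    (hu : IsWeakSolution s U A q F g u) (hE : FiniteEnergy s U u) (hum : Measurable u)
    (hu0 : ∀ x, 0 ≤ u x) (hη : IsTestFunction U η) {ε : ℝ} (hε : 0 < ε) :
    Integrable (energyDensity s A u fun x => η x ^ 2 * (u x + ε)⁻¹) volume ∧
    - ∫ p, energyDensity s A u (fun x => η x ^ 2 * (u x + ε)⁻¹) p
      ≤ potentialForm s U A q (η * η) := by
  have hUm := hU.1.measurableSet
  have hηS := hη.memSobolev hs0 hs1
  have hpos : ∀ x, 0 < u x + ε := fun x => by linarith [hu0 x]
  set φ : E n → ℝ := fun x => η x ^ 2 * (u x + ε)⁻¹ with hφdef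
  have hφ0 : ∀ x ∉ U, φ x = 0 := fun x hx => by simp [hφdef, hη.eq_zero hx]
  have hφ : MemSobolev s φ := by
    have h := hE.memSobolev_mul hs0 hs1 hUm hη.mul (v := fun x => (u x + ε)⁻¹)
      (by fun_prop) (M := ε⁻¹) (L := (ε * ε)⁻¹) (fun x => ?_)
      (fun x y => abs_inv_sub_inv_le hε (hu0 x) (hu0 y))
    · refine h.congr_ae (ae_of_all _ fun x => ?_)
      simp [hφdef, sq]
    · rw [abs_of_pos (inv_pos.2 (hpos x))]
      gcongr
      linarith [hu0 x]
  -- The choice of `w` makes uφ + w² = η², since u/(u+ε) = 1 - ε/(u+ε). The form is nonnegative on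
  -- w², so its value at uφ is at most its value at η².
  set w : E n → ℝ := η * fun x => √ε / √(u x + ε) with hwdef
  have hw : MemSobolev s w := by
    refine hE.memSobolev_mul hs0 hs1 hUm hη (by fun_prop) (M := 1) (fun x => ?_)
      (fun x y => abs_sqrt_div_sqrt_sub_le hε (hu0 x) (hu0 y))
    have : 0 < √(u x + ε) := Real.sqrt_pos.2 (hpos x)
    rw [abs_of_nonneg (by positivity), div_le_one this]
    exact Real.sqrt_le_sqrt (by linarith [hu0 x])
  have hw0 : ∀ x ∉ U, w x = 0 := fun x hx => by simp [hwdef, hη.eq_zero hx]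
  have hww : u * φ + w * w = η * η := by
    ext x
    have h1 : (√ε / √(u x + ε)) ^ 2 = ε / (u x + ε) := by
      rw [div_pow, Real.sq_sqrt hε.le, Real.sq_sqrt (hpos x).le]
    have h2 := (hpos x).ne'
    calc (u * φ + w * w) x = u x * (η x ^ 2 * (u x + ε)⁻¹) + η x ^ 2 * (√ε / √(u x + ε)) ^ 2 := by
          simp only [Pi.add_apply, Pi.mul_apply, hφdef, hwdef]; ring
      _ = (η * η) x := by
          rw [h1, Pi.mul_apply]
          field_simp
  have huφ : u * φ = η * η + (-w) * w := by
    rw [← hww]; ring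
  have hnw : MemSobolev s (-w) := by
    have h := (hw.sub hw).sub hw
    simpa using h
  have hpot : potentialForm s U A q (u * φ) =
      potentialForm s U A q (η * η) - potentialForm s U A q (w * w) := by
    rw [huφ, potentialForm_mul_add_mul hA hAc hq hηS hηS hnw hw, neg_mul, potentialForm_neg]
    ring
  have hwn := hAq.potentialForm_mul_self_nonneg hA hAc hq
    (hU.memSobolevTilde hs0 hs1 hUb hw hw0)
  have hen := hu.energy_eq hs0 hs1 hU hUb hA hAc hq hE hφ hφ0
  have hFφ : 0 ≤ ∫ x in U, F x * φ x := by
    refine integral_nonneg_of_ae ?_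
    filter_upwards [hF0] with x hx
    exact mul_nonneg hx (mul_nonneg (sq_nonneg _) (inv_nonneg.2 (hpos x).le))
  exact ⟨integrable_energyDensity hA hAc hUm hE hφ hφ0, by linarith⟩

/-- Picone's inequality: the gap between the two sides is exactly (xb - ya)²/(ab). -/
lemma mul_sub_mul_inv_le {a b x y : ℝ} (ha : 0 < a) (hb : 0 < b) :
    (a - b) * (x ^ 2 * a⁻¹ - y ^ 2 * b⁻¹) ≤ (x - y) ^ 2 := by
  have h : (x - y) ^ 2 - (a - b) * (x ^ 2 * a⁻¹ - y ^ 2 * b⁻¹) =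
      (x * b - y * a) ^ 2 * (a * b)⁻¹ := by
    field_simp; ring
  have : 0 ≤ (x * b - y * a) ^ 2 * (a * b)⁻¹ := by positivity
  linarith

/-- A nonnegative supersolution with nontrivial exterior values vanishes almost nowhere on the
support of a test function. -/
lemma IsWeakSolution.ae_eq_zero_of_eq_zero (hs0 : 0 < s) (hs1 : s < 1)
    (hU : IsLipschitzDomain U) (hUb : Bornology.IsBounded U) (hA : Continuous A)
    (hAc : HasCompactSupport A) (hAa : ∀ p, 0 ≤ dirComp (antisymmPart A) p)
    (hq : MemLp q ⊤ (volume.restrict U)) (hAq : PotentialCondition s U A q)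
    (hF0 : ∀ᵐ x ∂(volume.restrict U), 0 ≤ F x) (hu : IsWeakSolution s U A q F g u)
    (hE : FiniteEnergy s U u) (hum : Measurable u) (hu0 : ∀ x, 0 ≤ u x)
    (hune : ¬ u =ᵐ[volume.restrict (closure U)ᶜ] 0) (hη : IsTestFunction U η) :
    ∀ᵐ x : E n, u x = 0 → η x = 0 := by
  classical
  have hUm := hU.1.measurableSet
  have hηS := hη.memSobolev hs0 hs1
  have hηm : Measurable η := hη.1.continuous.measurable
  have hη0 : ∀ x ∉ U, η x = 0 := fun x hx => hη.eq_zero hx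
  have hηE : FiniteEnergy s U η := ⟨.of_memLp hηS.memLp, hηS.memLp_gagliardo.restrict _⟩
  have iη := integrable_energyDensity (A := A) hA hAc hUm hηE hηS hη0
  have hext : MeasurableSet (closure U)ᶜ := isClosed_closure.measurableSet.compl
  set c := √(fracConst n s / 2) with hc
  have hcpos : 0 < c := Real.sqrt_pos.2 (half_pos (fracConst_pos hs0 hs1))
  -- On these pairs the shifted test function equals η(x)²/ε at x and zero at y, so the energy
  -- density blows up like 1/ε unless u(y)η(x)² = 0.
  set T : Set (E n × E n) := {p | u p.1 = 0 ∧ p.2 ∈ (closure U)ᶜ} with hT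
  have hTm : MeasurableSet T :=
    ((hum.comp measurable_fst) (measurableSet_singleton 0)).inter (measurable_snd hext)
  set H : E n × E n → ℝ := T.indicator fun p => c ^ 2 * kappa s p ^ 2 * (u p.2 * η p.1 ^ 2) with hH
  have hHm : Measurable H := Measurable.indicator (by fun_prop) hTm
  have hH0 : ∀ p, 0 ≤ H p := fun p => indicator_nonneg (fun p _ => by have := hu0 p.2; positivity) p
  have hpt : ∀ ε : ℝ, 0 < ε → ∀ p, H p ≤ ε * (energyDensity s A η η p -
      energyDensity s A u (fun x => η x ^ 2 * (u x + ε)⁻¹) p) := by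
    intro ε hε p
    have ha : 0 < u p.1 + ε := by linarith [hu0 p.1]
    have hb : 0 < u p.2 + ε := by linarith [hu0 p.2]
    have hK : 0 ≤ c * (dirComp (antisymmPart A) p * kappa s p) :=
      mul_nonneg hcpos.le (mul_nonneg (hAa p) (kappa_nonneg p))
    have hdiff : energyDensity s A η η p -
        energyDensity s A u (fun x => η x ^ 2 * (u x + ε)⁻¹) p =
        (c ^ 2 * kappa s p ^ 2 + c * (dirComp (antisymmPart A) p * kappa s p)) *
        ((η p.1 - η p.2) ^ 2 - ((u p.1 + ε) - (u p.2 + ε)) *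
          (η p.1 ^ 2 * (u p.1 + ε)⁻¹ - η p.2 ^ 2 * (u p.2 + ε)⁻¹)) := by
      simp only [energyDensity, ← hc]; ring
    have h1 := mul_sub_mul_inv_le (x := η p.1) (y := η p.2) ha hb
    rw [hdiff]
    by_cases hp : p ∈ T
    · have hη2 : η p.2 = 0 := hη.eq_zero fun h => hp.2 (subset_closure h)
      have hu1 : u p.1 = 0 := hp.1
      have e : (η p.1 - η p.2) ^ 2 - ((u p.1 + ε) - (u p.2 + ε)) *
          (η p.1 ^ 2 * (u p.1 + ε)⁻¹ - η p.2 ^ 2 * (u p.2 + ε)⁻¹) =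
          η p.1 ^ 2 + u p.2 * η p.1 ^ 2 * ε⁻¹ := by
        rw [hη2, hu1]; ring
      rw [hH, indicator_of_mem hp, e]
      have h2 : ε * ((c ^ 2 * kappa s p ^ 2 + c * (dirComp (antisymmPart A) p * kappa s p)) *
          (η p.1 ^ 2 + u p.2 * η p.1 ^ 2 * ε⁻¹)) =
          (c ^ 2 * kappa s p ^ 2 + c * (dirComp (antisymmPart A) p * kappa s p)) *
          (ε * η p.1 ^ 2 + u p.2 * η p.1 ^ 2) := by
        field_simp
      rw [h2]
      have h3 : 0 ≤ u p.2 * η p.1 ^ 2 := mul_nonneg (hu0 _) (sq_nonneg _)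
      exact mul_le_mul (le_add_of_nonneg_right hK) (le_add_of_nonneg_left (by positivity)) h3
        (by positivity)
    · rw [hH, indicator_of_notMem hp]
      exact mul_nonneg hε.le (mul_nonneg (by positivity) (by linarith))
  have key : ∀ ε : ℝ, 0 < ε → _ := fun ε hε =>
    hu.neg_integral_energyDensity_le hs0 hs1 hU hUb hA hAc hq hAq hF0 hE hum hu0 hη hε
  have hHi : Integrable H volume := by
    refine ((iη.sub (key 1 one_pos).1).const_mul 1).mono' hHm.aestronglyMeasurable
      (ae_of_all _ fun p => ?_)
    rw [Real.norm_of_nonneg (hH0 p)]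
    exact hpt 1 one_pos p
  set C := (∫ p, energyDensity s A η η p) + potentialForm s U A q (η * η) with hC
  -- The constant `C` does not depend on ε, so letting ε tend to zero annihilates the integral of
  -- `H`.
  have hbound : ∀ ε : ℝ, 0 < ε → ∫ p, H p ≤ ε * C := by
    intro ε hε
    refine (integral_mono hHi ((iη.sub (key ε hε).1).const_mul ε) (hpt ε hε)).trans ?_
    rw [integral_const_mul]
    simp only [Pi.sub_apply]
    rw [integral_sub iη (key ε hε).1]
    exact mul_le_mul_of_nonneg_left (by linarith [(key ε hε).2]) hε.le
  have hHzero : ∫ p, H p = 0 := by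
    refine le_antisymm ?_ (integral_nonneg hH0)
    have hlim : Filter.Tendsto (fun ε : ℝ => ε * C) (nhdsWithin 0 (Ioi 0)) (nhds 0) :=
      ((continuous_id.mul continuous_const).tendsto' 0 0 (by simp)).mono_left nhdsWithin_le_nhds
    exact ge_of_tendsto hlim (by filter_upwards [self_mem_nhdsWithin] with ε hε using hbound ε hε)
  have hae := (integral_eq_zero_iff_of_nonneg hH0 hHi).1 hHzero
  have hprod : ∀ᵐ x : E n, ∀ᵐ y : E n, H (x, y) = 0 := Measure.ae_ae_of_ae_prod hae
  filter_upwards [hprod] with x hx hux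
  by_contra hηx
  have hxU : x ∈ U := by by_contra h; exact hηx (hη0 x h)
  refine hune ((ae_restrict_iff' hext).2 ?_)
  filter_upwards [hx] with y hy hyU
  have hne : x ≠ y := fun h => hyU (h ▸ subset_closure hxU)
  have hk := kappa_pos (s := s) (p := (x, y)) hne
  have hmem : (x, y) ∈ T := ⟨hux, hyU⟩
  rw [hH, indicator_of_mem hmem] at hy
  simpa [hk.ne', hcpos.ne', hηx] using hy

lemma exists_isTestFunction_eq_one (hU : IsOpen U) {x : E n} (hx : x ∈ U) :
    ∃ η : E n → ℝ, IsTestFunction U η ∧ ∀ᶠ y in nhds x, η y = 1 := by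
  obtain ⟨r, hr, hsub⟩ := Metric.nhds_basis_closedBall.mem_iff.1 (hU.mem_nhds hx)
  let f : ContDiffBump x := ⟨r / 2, r, by positivity, half_lt_self hr⟩
  refine ⟨f, ⟨f.contDiff, f.hasCompactSupport, ?_⟩, f.eventuallyEq_one⟩
  rw [f.tsupport_eq]
  exact hsub

/-- **Strong maximum principle** for the fractional magnetic operator. -/
theorem IsWeakSolution.pos (hs0 : 0 < s) (hs1 : s < 1) (hU : IsLipschitzDomain U)
    (hUb : Bornology.IsBounded U) (hA : Continuous A) (hAc : HasCompactSupport A)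
    (hAa : ∀ p, 0 ≤ dirComp (antisymmPart A) p) (hq : MemLp q ⊤ (volume.restrict U))
    (hAq : PotentialCondition s U A q) (hF0 : ∀ᵐ x ∂(volume.restrict U), 0 ≤ F x)
    (hg : MemLp g ⊤ (volume.restrict (closure U)ᶜ))
    (hg0 : ∀ᵐ x ∂(volume.restrict (closure U)ᶜ), 0 ≤ g x)
    (hgne : ¬ g =ᵐ[volume.restrict (closure U)ᶜ] 0) (hu : IsWeakSolution s U A q F g u) :
    ∀ᵐ x ∂(volume.restrict U), 0 < u x := by
  have hext : volume (closure U)ᶜ ≠ 0 := by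
    intro h
    refine hgne ?_
    rw [Measure.restrict_eq_zero.2 h]
    exact ae_zero.le trivial
  have hnn := hu.nonneg hs0 hs1 hU hUb hA hAc hAa hq hAq hF0 hg hg0 hext
  -- Weak solutions are stable under almost everywhere equality, so the absolute value of a
  -- measurable representative may be used; it is nonnegative at every point.
  wlog h : Measurable u ∧ ∀ x, 0 ≤ u x generalizing u
  · have hm := (hu.finiteEnergy hs0 hs1 hU hg).locL2.meas
    have he : u =ᵐ[volume] fun x => |hm.mk u x| := by
      filter_upwards [hnn, hm.ae_eq_mk] with x h1 h2
      rw [← h2, abs_of_nonneg h1]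
    have h1 := this (hu.congr_ae he) (ae_of_all _ fun x => abs_nonneg _)
      ⟨hm.stronglyMeasurable_mk.measurable.norm, fun x => abs_nonneg _⟩
    filter_upwards [h1, ae_restrict_of_ae he] with x h1 h2
    rw [h2]; exact h1
  obtain ⟨hum, hu0⟩ := h
  have hE := hu.finiteEnergy hs0 hs1 hU hg
  have hune : ¬ u =ᵐ[volume.restrict (closure U)ᶜ] 0 := fun h => hgne (hu.exterior.symm.trans h)
  have hnull : volume {x | x ∈ U ∧ u x = 0} = 0 := by
    -- Near each point of `U` some test function equals one, so the zero set is null in a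
    -- neighbourhood of each of its points.
    refine measure_null_of_locally_null _ fun x hx => ?_
    obtain ⟨η, hη, hη1⟩ := exists_isTestFunction_eq_one hU.1 hx.1
    have hae := hu.ae_eq_zero_of_eq_zero hs0 hs1 hU hUb hA hAc hAa hq hAq hF0 hE hum hu0 hune hη
    refine ⟨{x | x ∈ U ∧ u x = 0} ∩ {y | η y = 1}, Filter.inter_mem self_mem_nhdsWithin
      (mem_nhdsWithin_of_mem_nhds hη1), measure_mono_null ?_ hae⟩
    rintro y ⟨hy, hy1⟩ hcon
    have h1 : η y = 1 := hy1
    simp [hcon hy.2] at h1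
  rw [ae_restrict_iff' hU.1.measurableSet]
  filter_upwards [measure_eq_zero_iff_ae_notMem.1 hnull] with x hx hxU
  exact lt_of_le_of_ne (hu0 x) fun h => hx ⟨hxU, h.symm⟩

lemma IsHolderCompact.continuous (hs0 : 0 < s) (hA : IsHolderCompact s A) : Continuous A := by
  obtain ⟨C, hC⟩ := hA.1
  exact (hC.uniformContinuous (Real.toNNReal_pos.2 hs0)).continuous

end

end FracMagnetic

end

theorem mainTheorem5 (n : ℕ) (s : ℝ) (hs0 : 0 < s) (hs1 : s < 1)
    (Ω : Set (FracMagnetic.E n)) (hΩb : Bornology.IsBounded Ω)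
    (hΩ : FracMagnetic.IsLipschitzDomain Ω)
    (A : FracMagnetic.E n × FracMagnetic.E n → FracMagnetic.E n)
    (hA : FracMagnetic.IsHolderCompact s A) (hAc : FracMagnetic.MagneticCondition s A)
    (q : FracMagnetic.E n → ℝ) (hq : MemLp q ⊤ (volume.restrict Ω))
    (hAq : FracMagnetic.PotentialCondition s Ω A q)
    (F : FracMagnetic.E n → ℝ) (hF : MemLp F ⊤ (volume.restrict Ω))
    (hF0 : ∀ᵐ x ∂(volume.restrict Ω), 0 ≤ F x)
    (g : FracMagnetic.E n → ℝ) (hg : MemLp g ⊤ (volume.restrict (closure Ω)ᶜ))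
    (hg0 : ∀ᵐ x ∂(volume.restrict (closure Ω)ᶜ), 0 ≤ g x)
    (hgne : ¬ g =ᵐ[volume.restrict (closure Ω)ᶜ] 0)
    (u : FracMagnetic.E n → ℝ) (hu : FracMagnetic.IsWeakSolution s Ω A q F g u) :
    ∀ᵐ x ∂(volume.restrict Ω), 0 < u x := by
  have hAa : ∀ p, 0 ≤ FracMagnetic.dirComp (FracMagnetic.antisymmPart A) p :=
    FracMagnetic.dirComp_nonneg hAc.2
  exact hu.pos hs0 hs1 hΩ hΩb (hA.continuous hs0) hA.2 hAa hq hAq hF0 hg hg0 hgne
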